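/- For $\tfrac12<\sigma<1$ and $h\in L^2(\mathbb R)$ (complex valued), let $H(t)=\int_{\mathbb R}h(x)e^{itx}\,dx$ be the Fourier transform of $h$ (in the sense of Plancherel), let $\psi=\Gamma'/\Gamma$ be the digamma function, and consider the integral equation $$h(x)=e^{\sigma x}\int_{\mathbb R}e^{-\sigma y}\bigl(\psi(e^{x-y}+1)+y-x\bigr)\phi(y)\,dy\quad\text{for almost every }x\in\mathbb R. \qquad (*)$$ A solution means a function $\phi\in L^2(\mathbb R)+L^\infty(\mathbb R)$ for which the integral converges absolutely and $(*)$ holds for almost every $x$; functions equal almost everywhere are identified. Write $$Q_{\sigma,h}(y)=\frac{\sin(\pi(\sigma+iy))\,H(y)}{\zeta(1-\sigma-iy)}.$$ 1. The Riemann Hypothesis holds if and only if, for every $\sigma\in(\tfrac12,1)$ and every $h\in L^2(\mathbb R)$ with $Q_{\sigma,h}\in L^2(\mathbb R)$, equation $(*)$ has a unique solution. 2. The Riemann Hypothesis holds if and only if, for every $\sigma\in(\tfrac12,1)$ and every $h\in L^2(\mathbb R)$, equation $(*)$ has at most one solution. 3. For every $\sigma\in(\tfrac12,1)$ and every $h\in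 L^2(\mathbb R)$ with $Q_{\sigma,h}\in L^2(\mathbb R)$, the function $$\phi(x)=-\frac{1}{2\pi^2}\int_{\mathbb R}\frac{\sin(\pi(\sigma+iy))\,H(y)\,e^{-ixy}}{\zeta(1-\sigma-iy)}\,dy$$ (the integral in the sense of Plancherel) belongs to $L^2(\mathbb R)$ and is a solution of $(*)$; under the Riemann Hypothesis it is the only one. -/

import Mathlib

open MeasureTheory
open scoped FourierTransform

noncomputable section

/-- The kernel `e^{-σ y} (ψ(e^{x-y} + 1) + y - x)`, where `ψ` is the digamma function. -/
def digammaKernel (σ x y : ℝ) : ℂ :=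
  (Real.exp (-σ * y) : ℂ) *
    (Complex.digamma ((Real.exp (x - y) + 1 : ℝ) : ℂ) + (y : ℂ) - (x : ℂ))

/-- The admissible unknowns: functions in `L²(ℝ) + L^∞(ℝ)`, the smallest vector space containing
both the square integrable functions and the (essentially) bounded functions. -/
def IsSquareIntegrableAddBounded (φ : ℝ → ℂ) : Prop :=
  ∃ φ₁ φ₂ : ℝ → ℂ, MemLp φ₁ 2 volume ∧ MemLp φ₂ ⊤ volume ∧ φ = fun y => φ₁ y + φ₂ y

/-- `φ` solves `h(x) = e^{σ x} ∫ e^{-σ y} (ψ(e^{x-y} + 1) + y - x) φ(y) dy` for almost every `x`,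
the integral being absolutely convergent. -/
def IsDigammaSolution (σ : ℝ) (h φ : ℝ → ℂ) : Prop :=
  IsSquareIntegrableAddBounded φ ∧
    ∀ᵐ x : ℝ, Integrable (fun y : ℝ => digammaKernel σ x y * φ y) volume ∧
      h x = (Real.exp (σ * x) : ℂ) * ∫ y : ℝ, digammaKernel σ x y * φ y

/-- The `L²` (Plancherel) Fourier transform `H(t) = ∫ h(x) e^{i t x} dx`. Mathlib's inverse
transform has the kernel `e^{2 π i w x}`, hence the substitution `w = t / (2 π)`. -/
def plancherelPlus (h : ℝ → ℂ) (hh : MemLp h 2 volume) : ℝ → ℂ :=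
  fun t => (𝓕⁻ (hh.toLp h) : Lp ℂ 2 (volume : Measure ℝ)) (t / (2 * Real.pi))

/-- The `L²` (Plancherel) integral `∫ q(y) e^{-i x y} dy`, as a function of `x`. Mathlib's
transform has the kernel `e^{-2 π i w y}`, hence the substitution `w = x / (2 π)`. -/
def plancherelMinus (q : ℝ → ℂ) (hq : MemLp q 2 volume) : ℝ → ℂ :=
  fun x => (𝓕 (hq.toLp q) : Lp ℂ 2 (volume : Measure ℝ)) (x / (2 * Real.pi))

/-- The quotient `sin(π(σ + i y)) H(y) / ζ(1 - σ - i y)`, with `H` the Fourier transform of `h`. -/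
def zetaQuotient (σ : ℝ) (h : ℝ → ℂ) (hh : MemLp h 2 volume) : ℝ → ℂ :=
  fun y => Complex.sin ((Real.pi : ℂ) * ((σ : ℂ) + Complex.I * (y : ℂ))) * plancherelPlus h hh y /
    riemannZeta (1 - (σ : ℂ) - Complex.I * (y : ℂ))

/-- The function
`φ(x) = -(1 / (2 π²)) ∫ sin(π(σ + i y)) H(y) e^{-i x y} / ζ(1 - σ - i y) dy`. -/
def explicitSolution (σ : ℝ) (h : ℝ → ℂ) (hh : MemLp h 2 volume)
    (hq : MemLp (zetaQuotient σ h hh) 2 volume) : ℝ → ℂ :=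
  fun x => -(1 / (2 * (Real.pi : ℂ) ^ 2)) * plancherelMinus (zetaQuotient σ h hh) hq x

end

/-! The equation is a convolution equation `h = k * φ`, with kernel `k(u) = e^{σu} (ψ(e^u + 1) - u)`
in `L¹ ∩ L²`. The substitution `x = e^u` turns the transform of `k` at `t` into the Mellin transform
of `ψ(x + 1) - log x` at `s = σ + it`. Binet's formula writes that function as the Laplace transform
of `1/t - 1/(e^t - 1)`, whose own Mellin transform is `-Γζ` on `0 < re s < 1`. Fubini and the
reflection formula then give the multiplier `-π ζ(1 - s) / sin(πs)` (`fourierInv_convKernel`), which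
vanishes exactly at the zeros of `ζ` on the line `re = 1 - σ`.

Existence is unconditional: those zeros are countable, so `H` may be divided by the multiplier
almost everywhere, and `Q ∈ L²` makes the quotient the transform of an `L²` solution
(`isDigammaSolution_explicitSolution`).

Uniqueness depends on every single zero, because bounded functions are admitted. A zero `1 - σ - it`
makes `e^{-ity}` a homogeneous solution (`isDigammaSolution_exp`). Without zeros on the line the
reciprocal of the multiplier is smooth, so each test function `η` is the multiplier times another
test function; a homogeneous solution is therefore orthogonal to every `𝓕 η` and vanishes
(`IsSquareIntegrableAddBounded.ae_eq_zero_of_convolution_eq_zero`). As `σ` runs over `(1/2, 1)`, the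
line `re = 1 - σ` sweeps the left half of the critical strip, and by the functional equation RH says
that this half contains no zero. -/

open scoped ContDiff
open Set Filter Asymptotics Topology SchwartzMap

/-! ### Mellin transform of the Binet density -/

/-- `1 / (e ^ t - 1) ≤ 1 / t` for positive `t`. -/
theorem inv_exp_sub_one_le_inv {t : ℝ} (ht : 0 < t) : 1 / (Real.exp t - 1) ≤ 1 / t :=
  one_div_le_one_div_of_le ht (by linarith [Real.add_one_le_exp t])

theorem exp_sub_one_pos {t : ℝ} (ht : 0 < t) : 0 < Real.exp t - 1 := by
  linarith [Real.add_one_lt_exp ht.ne']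

/-- The function `1 / t - 1 / (e ^ t - 1)`, the Laplace density of `ψ (x + 1) - log x`. -/
noncomputable def binetDensity (t : ℝ) : ℝ := 1 / t - 1 / (Real.exp t - 1)

theorem binetDensity_nonneg {t : ℝ} (ht : 0 < t) : 0 ≤ binetDensity t :=
  sub_nonneg.2 (inv_exp_sub_one_le_inv ht)

theorem binetDensity_le_one {t : ℝ} (ht : 0 < t) : binetDensity t ≤ 1 := by
  have h := exp_sub_one_pos ht
  have h1 : Real.exp t * (1 - t) ≤ 1 := by
    have := mul_le_mul_of_nonneg_left (Real.one_sub_le_exp_neg t) (Real.exp_pos t).le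
    rwa [← Real.exp_add, add_neg_cancel, Real.exp_zero] at this
  rw [binetDensity, div_sub_div _ _ ht.ne' h.ne', div_le_one (by positivity)]
  linarith

theorem measurable_binetDensity : Measurable binetDensity := by
  unfold binetDensity; fun_prop

theorem continuousOn_inv_exp_sub_one :
    ContinuousOn (fun t : ℝ => 1 / (Real.exp t - 1)) (Set.Ioi 0) :=
  ContinuousOn.div (by fun_prop) (by fun_prop) fun _ ht => (exp_sub_one_pos ht).ne'

theorem isBigO_inv_exp_sub_one_atTop :
    (fun t : ℝ => ((1 / (Real.exp t - 1) : ℝ) : ℂ)) =O[atTop] fun t => Real.exp (-1 * t) := by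
  refine IsBigO.of_bound 2 ?_
  filter_upwards [eventually_ge_atTop 1] with t ht
  have h2 : 2 ≤ Real.exp t := by linarith [Real.add_one_le_exp t]
  rw [Complex.norm_real, Real.norm_of_nonneg (by apply one_div_nonneg.2; linarith),
    Real.norm_of_nonneg (Real.exp_pos _).le, neg_one_mul, Real.exp_neg, ← div_eq_mul_inv,
    div_le_div_iff₀ (by linarith) (by linarith)]
  linarith

/-- The Mellin transform of `1 / (e ^ t - 1)` is `Γ ζ` on `1 < re s`. -/
theorem hasMellin_inv_exp_sub_one {s : ℂ} (hs : 1 < s.re) :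
    HasMellin (fun t : ℝ => ((1 / (Real.exp t - 1) : ℝ) : ℂ)) s
      (Complex.Gamma s * riemannZeta s) := by
  constructor
  · refine mellinConvergent_of_isBigO_rpow_exp one_pos (b := 1) ?_ isBigO_inv_exp_sub_one_atTop
      ?_ hs
    · exact (Complex.continuous_ofReal.comp_continuousOn
        continuousOn_inv_exp_sub_one).locallyIntegrableOn measurableSet_Ioi
    · refine IsBigO.of_bound 1 ?_
      filter_upwards [self_mem_nhdsWithin] with t ht
      have ht : 0 < t := ht
      rw [Complex.norm_real, Real.norm_of_nonneg (one_div_pos.2 (exp_sub_one_pos ht)).le,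
        Real.rpow_neg_one, Real.norm_of_nonneg (by positivity), one_mul, ← one_div]
      exact inv_exp_sub_one_le_inv ht
  -- Termwise Mellin transform of the geometric series `1/(e^t - 1) = ∑ e^{-(n+1)t}`.
  · have key := hasSum_mellin (ι := ℕ) (a := fun _ => 1) (p := fun n => n + 1)
      (F := fun t : ℝ => ((1 / (Real.exp t - 1) : ℝ) : ℂ)) (s := s)
      (fun i => Or.inr (by positivity)) (by linarith) ?_ ?_
    · have h2 := key.tsum_eq
      rw [← h2, zeta_eq_tsum_one_div_nat_add_one_cpow hs, ← tsum_mul_left]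
      refine tsum_congr fun n => ?_
      push_cast
      ring
    · intro t ht
      have ht : 0 < t := ht
      have h := hasSum_geometric_of_lt_one (Real.exp_pos (-t)).le
        (by rw [Real.exp_lt_one_iff]; linarith)
      have h3 := h.mul_left (Real.exp (-t))
      have h4 : Real.exp (-t) * (1 - Real.exp (-t))⁻¹ = 1 / (Real.exp t - 1) := by
        have := exp_sub_one_pos ht
        have h5 : (1 - Real.exp (-t)) ≠ 0 := by
          have : Real.exp (-t) < 1 := by rw [Real.exp_lt_one_iff]; linarith
          linarith
        rw [← div_eq_mul_inv, div_eq_div_iff h5 this.ne', mul_sub, ← Real.exp_add]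
        simp
      rw [h4] at h3
      have h6 := Complex.hasSum_ofReal.2 h3
      convert h6 using 2 with n
      rw [one_mul, ← Real.exp_nat_mul, ← Real.exp_add]
      congr 2
      ring
    · have := (summable_nat_add_iff 1).2 (Real.summable_one_div_nat_rpow.2 hs)
      simpa using this

/-- `1 / (e ^ t - 1)` with its singularity at `0` cut off. -/
theorem hasMellin_truncated {s : ℂ} (hs : 1 < s.re) :
    mellin (fun t : ℝ => ((1 / (Real.exp t - 1) : ℝ) : ℂ) -
      indicator (Ioc 0 1) (fun t : ℝ => (t : ℂ) ^ (-1 : ℂ)) t) s =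
      Complex.Gamma s * riemannZeta s - 1 / (s - 1) := by
  have h1 := hasMellin_inv_exp_sub_one hs
  have h2 := hasMellin_cpow_Ioc (-1) (s := s) (by simp; linarith)
  rw [(hasMellin_sub h1.1 h2.1).2, h1.2, h2.2, sub_eq_add_neg s 1]

theorem sub_indicator_eq_neg_binetDensity {t : ℝ} (ht : t ∈ Ioc (0 : ℝ) 1) :
    ((1 / (Real.exp t - 1) : ℝ) : ℂ) -
      indicator (Ioc 0 1) (fun t : ℝ => (t : ℂ) ^ (-1 : ℂ)) t = -(binetDensity t : ℂ) := by
  rw [indicator_of_mem ht, Complex.cpow_neg_one, binetDensity]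
  push_cast
  ring

/-- Removing `1/t` only on `(0, 1]` leaves a bounded function near `0` and keeps the exponential
decay at infinity, so the half-plane of convergence grows from `1 < re s` to `0 < re s`. -/
theorem differentiableAt_mellin_truncated {s : ℂ} (hs : 0 < s.re) :
    MellinConvergent (fun t : ℝ => ((1 / (Real.exp t - 1) : ℝ) : ℂ) -
      indicator (Ioc 0 1) (fun t : ℝ => (t : ℂ) ^ (-1 : ℂ)) t) s ∧
    DifferentiableAt ℂ (mellin (fun t : ℝ => ((1 / (Real.exp t - 1) : ℝ) : ℂ) -
      indicator (Ioc 0 1) (fun t : ℝ => (t : ℂ) ^ (-1 : ℂ)) t)) s := by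
  have hloc : LocallyIntegrableOn (fun t : ℝ => ((1 / (Real.exp t - 1) : ℝ) : ℂ) -
      indicator (Ioc 0 1) (fun t : ℝ => (t : ℂ) ^ (-1 : ℂ)) t) (Ioi 0) := by
    refine LocallyIntegrableOn.sub ?_ ?_
    · exact (Complex.continuous_ofReal.comp_continuousOn
        continuousOn_inv_exp_sub_one).locallyIntegrableOn measurableSet_Ioi
    · have h1 : LocallyIntegrableOn (fun t : ℝ => (t : ℂ) ^ (-1 : ℂ)) (Ioi 0) := by
        refine ContinuousOn.locallyIntegrableOn (fun t ht => ?_) measurableSet_Ioi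
        exact (Complex.continuousAt_ofReal_cpow_const t _
          (Or.inr (ne_of_gt ht))).continuousWithinAt
      rw [locallyIntegrableOn_iff (isLocallyClosed_Ioi)] at h1 ⊢
      intro k hk hk2
      exact (h1 k hk hk2).indicator measurableSet_Ioc
  have htop : (fun t : ℝ => ((1 / (Real.exp t - 1) : ℝ) : ℂ) -
      indicator (Ioc 0 1) (fun t : ℝ => (t : ℂ) ^ (-1 : ℂ)) t)
      =O[atTop] fun t => Real.exp (-1 * t) := by
    refine isBigO_inv_exp_sub_one_atTop.congr' ?_ EventuallyEq.rfl
    filter_upwards [eventually_gt_atTop 1] with t ht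
    rw [indicator_of_notMem (by simp [ht]), sub_zero]
  have hbot : (fun t : ℝ => ((1 / (Real.exp t - 1) : ℝ) : ℂ) -
      indicator (Ioc 0 1) (fun t : ℝ => (t : ℂ) ^ (-1 : ℂ)) t)
      =O[𝓝[>] 0] (· ^ (-(0 : ℝ))) := by
    refine IsBigO.of_bound 1 ?_
    filter_upwards [Ioc_mem_nhdsGT (zero_lt_one' ℝ)] with t ht
    rw [sub_indicator_eq_neg_binetDensity ht, norm_neg, Complex.norm_real,
      Real.norm_of_nonneg (binetDensity_nonneg ht.1)]
    simpa using binetDensity_le_one ht.1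
  exact ⟨mellinConvergent_of_isBigO_rpow_exp one_pos hloc htop hbot hs,
    mellin_differentiableAt_of_isBigO_rpow_exp one_pos hloc htop hbot hs⟩

/-- Identity theorem on `0 < re s`. The factor `s - 1` clears the pole at `1`, so that both sides
are holomorphic there; they agree for `1 < re s`. -/
theorem sub_one_mul_mellin_truncated {s : ℂ} (hs : 0 < s.re) :
    (s - 1) * mellin (fun t : ℝ => ((1 / (Real.exp t - 1) : ℝ) : ℂ) -
      indicator (Ioc 0 1) (fun t : ℝ => (t : ℂ) ^ (-1 : ℂ)) t) s =
      Complex.Gamma s * riemannZeta₁ s - 1 := by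
  have hopen : IsOpen {z : ℂ | 0 < z.re} := isOpen_lt continuous_const Complex.continuous_re
  have hpre : IsPreconnected {z : ℂ | 0 < z.re} :=
    (convex_halfSpace_re_gt 0).isPreconnected
  have hf : AnalyticOnNhd ℂ (fun s => (s - 1) * mellin (fun t : ℝ =>
      ((1 / (Real.exp t - 1) : ℝ) : ℂ) -
      indicator (Ioc 0 1) (fun t : ℝ => (t : ℂ) ^ (-1 : ℂ)) t) s) {z : ℂ | 0 < z.re} := by
    refine DifferentiableOn.analyticOnNhd (fun z hz => ?_) hopen
    exact ((differentiableAt_id.sub_const 1).mul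
      (differentiableAt_mellin_truncated hz).2).differentiableWithinAt
  have hg : AnalyticOnNhd ℂ (fun s => Complex.Gamma s * riemannZeta₁ s - 1)
      {z : ℂ | 0 < z.re} := by
    refine DifferentiableOn.analyticOnNhd (fun z hz => ?_) hopen
    have hz : 0 < z.re := hz
    refine (((Complex.differentiableAt_Gamma z fun m hm => ?_).mul
      (differentiable_riemannZeta₁ z)).sub_const 1).differentiableWithinAt
    rw [hm] at hz
    simp at hz
    linarith [(Nat.cast_nonneg m : (0 : ℝ) ≤ m)]
  refine hf.eqOn_of_preconnected_of_eventuallyEq hg hpre (z₀ := 2) (by simp) ?_ hs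
  have hnhds : {z : ℂ | 1 < z.re} ∈ 𝓝 (2 : ℂ) :=
    (isOpen_lt continuous_const Complex.continuous_re).mem_nhds (by simp)
  filter_upwards [hnhds] with z hz
  have hz1 : z ≠ 1 := by
    rintro rfl
    simp at hz
  rw [hasMellin_truncated hz, riemannZeta_eq_inv_sub_mul hz1]
  have := sub_ne_zero.2 hz1
  field_simp

/-- The Mellin transform of `1 / t - 1 / (e ^ t - 1)` is `-Γ ζ` on `0 < re s < 1`. -/
theorem hasMellin_binetDensity {s : ℂ} (hs : 0 < s.re) (hs1 : s.re < 1) :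
    HasMellin (fun t : ℝ => (binetDensity t : ℂ)) s
      (-(Complex.Gamma s * riemannZeta s)) := by
  have hne : s ≠ 1 := by
    rintro rfl
    simp at hs1
  have hI := integrableOn_Ioi_cpow_of_lt (a := s - 2) (c := 1) (by simp; linarith) one_pos
  have hI2 := integral_Ioi_cpow_of_lt (a := s - 2) (c := 1) (by simp; linarith) one_pos
  have hfun : ∀ t ∈ Ioi (0 : ℝ), (t : ℂ) ^ (s - 1) •
      indicator (Ioi 1) (fun t : ℝ => (t : ℂ) ^ (-1 : ℂ)) t =
      indicator (Ioi 1) (fun t : ℝ => (t : ℂ) ^ (s - 2)) t := by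
    intro t ht
    by_cases h : t ∈ Ioi (1 : ℝ)
    · rw [indicator_of_mem h, indicator_of_mem h, smul_eq_mul,
        ← Complex.cpow_add _ _ (by exact_mod_cast (ne_of_gt ht))]
      ring_nf
    · rw [indicator_of_notMem h, indicator_of_notMem h, smul_zero]
  have hinter : Ioi (0 : ℝ) ∩ Ioi 1 = Ioi 1 := by
    exact inter_eq_right.2 (Ioi_subset_Ioi zero_le_one)
  -- For `re s < 1` the missing piece of `1/t`, on `(1, ∞)`, has a convergent Mellin transform,
  -- which cancels the polar term `1/(s - 1)`.
  have htail : HasMellin (indicator (Ioi 1) (fun t : ℝ => (t : ℂ) ^ (-1 : ℂ))) s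
      (-(1 / (s - 1))) := by
    constructor
    · refine IntegrableOn.congr_fun ?_ (fun t ht => (hfun t ht).symm) measurableSet_Ioi
      rw [IntegrableOn, integrable_indicator_iff measurableSet_Ioi, IntegrableOn,
        Measure.restrict_restrict measurableSet_Ioi, inter_comm, hinter]
      exact hI
    · rw [mellin, setIntegral_congr_fun measurableSet_Ioi hfun,
        setIntegral_indicator measurableSet_Ioi, hinter, hI2]
      have h1 : s - 2 + 1 = s - 1 := by ring
      rw [h1]
      simp [neg_div]
  have hF := (differentiableAt_mellin_truncated hs).1
  have hsub := hasMellin_sub htail.1 hF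
  have heq : ∀ t ∈ Ioi (0 : ℝ), (binetDensity t : ℂ) =
      indicator (Ioi 1) (fun t : ℝ => (t : ℂ) ^ (-1 : ℂ)) t -
        (((1 / (Real.exp t - 1) : ℝ) : ℂ) -
      indicator (Ioc 0 1) (fun t : ℝ => (t : ℂ) ^ (-1 : ℂ)) t) := by
    intro t ht
    by_cases h : t ≤ 1
    · rw [sub_indicator_eq_neg_binetDensity ⟨ht, h⟩, indicator_of_notMem (by simpa using h)]
      ring
    · push Not at h
      rw [indicator_of_mem (mem_Ioi.2 h), indicator_of_notMem (by simp [h]), Complex.cpow_neg_one,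
        binetDensity]
      push_cast
      ring
  constructor
  · exact IntegrableOn.congr_fun hsub.1 (fun t ht => by simp only [heq t ht]) measurableSet_Ioi
  · have h1 : mellin (fun t : ℝ => (binetDensity t : ℂ)) s = -(1 / (s - 1)) -
        mellin (fun t : ℝ => ((1 / (Real.exp t - 1) : ℝ) : ℂ) -
      indicator (Ioc 0 1) (fun t : ℝ => (t : ℂ) ^ (-1 : ℂ)) t) s := by
      rw [← htail.2, ← hsub.2]
      exact setIntegral_congr_fun measurableSet_Ioi fun t ht => by simp only [heq t ht]
    have h2 := sub_one_mul_mellin_truncated hs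
    have h3 := sub_ne_zero.2 hne
    rw [h1, riemannZeta_eq_inv_sub_mul hne]
    field_simp
    linear_combination -h2

/-! ### Digamma bounds and Binet's formula -/

/-- The real function `ψ (x + 1) - log x`. -/
noncomputable def digammaGap (x : ℝ) : ℝ := deriv (Real.log ∘ Real.Gamma) (x + 1) - Real.log x

theorem differentiableAt_log_Gamma {x : ℝ} (hx : 0 < x) :
    DifferentiableAt ℝ (Real.log ∘ Real.Gamma) x := by
  refine (Real.differentiableAt_log (Real.Gamma_pos_of_pos hx).ne').comp x
    (Real.differentiableAt_Gamma fun m h => ?_)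
  rw [h] at hx
  linarith [(Nat.cast_nonneg m : (0 : ℝ) ≤ m)]

/-- Passing to the real `log Γ` makes its convexity available. -/
theorem Complex.digamma_ofReal {x : ℝ} (hx : 0 < x) :
    Complex.digamma (x : ℂ) = ((deriv (Real.log ∘ Real.Gamma) x : ℝ) : ℂ) := by
  have hne : ∀ m : ℕ, x ≠ -m := fun m h => by
    rw [h] at hx
    linarith [(Nat.cast_nonneg m : (0 : ℝ) ≤ m)]
  have hd := Real.differentiableAt_Gamma hne
  have hc : DifferentiableAt ℂ Complex.Gamma (x : ℂ) :=
    Complex.differentiableAt_Gamma _ fun m h => hne m (by exact_mod_cast h)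
  have h1 : deriv Complex.Gamma (x : ℂ) = ((deriv Real.Gamma x : ℝ) : ℂ) := by
    have h2 := hc.hasDerivAt.comp_ofReal
    have h3 := hd.hasDerivAt.ofReal_comp
    refine h2.unique (h3.congr_of_eventuallyEq (Eventually.of_forall fun y => ?_))
    exact Complex.Gamma_ofReal y
  rw [Complex.digamma_def, logDeriv_apply, h1, Complex.Gamma_ofReal, ← Complex.ofReal_div]
  congr 1
  exact ((Real.hasDerivAt_log (Real.Gamma_pos_of_pos hx).ne').comp x hd.hasDerivAt).deriv ▸ by
    rw [div_eq_inv_mul]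

theorem digamma_sub_log {x : ℝ} (hx : 0 < x) :
    Complex.digamma ((x + 1 : ℝ) : ℂ) - (Real.log x : ℂ) = (digammaGap x : ℂ) := by
  rw [Complex.digamma_ofReal (by linarith), digammaGap, Complex.ofReal_sub]

theorem log_Gamma_add_one {x : ℝ} (hx : 0 < x) :
    (Real.log ∘ Real.Gamma) (x + 1) = Real.log x + (Real.log ∘ Real.Gamma) x := by
  simp only [Function.comp]
  rw [Real.Gamma_add_one hx.ne', Real.log_mul hx.ne' (Real.Gamma_pos_of_pos hx).ne']

/-- By convexity the slope of `log Γ` over `[x, x + 1]`, which is `log x`, is at most the derivative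
at the right end. The upper bound uses `[x + 1, x + 2]` and the left end. -/
theorem digammaGap_nonneg {x : ℝ} (hx : 0 < x) : 0 ≤ digammaGap x := by
  have h := Real.convexOn_log_Gamma.slope_le_of_hasDerivAt (x := x) (y := x + 1)
    hx (by simp; linarith) (by linarith)
    (differentiableAt_log_Gamma (by linarith : 0 < x + 1)).hasDerivAt
  rw [slope_def_field, log_Gamma_add_one hx] at h
  rw [digammaGap, sub_nonneg]
  simpa using h

theorem digammaGap_le {x : ℝ} (hx : 0 < x) : digammaGap x ≤ Real.log (x + 1) - Real.log x := by
  have h := Real.convexOn_log_Gamma.le_slope_of_hasDerivAt (x := x + 1) (y := x + 1 + 1)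
    (by simp; linarith) (by simp; linarith) (by linarith)
    (differentiableAt_log_Gamma (by linarith : 0 < x + 1)).hasDerivAt
  rw [slope_def_field, log_Gamma_add_one (by linarith : 0 < x + 1)] at h
  rw [digammaGap]
  have : deriv (Real.log ∘ Real.Gamma) (x + 1) ≤ Real.log (x + 1) := by simpa using h
  linarith

theorem log_add_one_sub_log {x : ℝ} (hx : 0 < x) :
    Real.log (x + 1) - Real.log x = Real.log (1 + 1 / x) := by
  rw [← Real.log_div (by linarith) hx.ne', add_div, div_self hx.ne']

theorem digammaGap_le_inv {x : ℝ} (hx : 0 < x) : digammaGap x ≤ 1 / x := by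
  refine (digammaGap_le hx).trans ?_
  rw [log_add_one_sub_log hx]
  have := Real.log_le_sub_one_of_pos (show 0 < 1 + 1 / x by positivity)
  linarith

theorem digammaGap_add_one {x : ℝ} (hx : 0 < x) :
    digammaGap x - digammaGap (x + 1) = Real.log ((x + 1) / x) - 1 / (x + 1) := by
  have hx1 : 0 < x + 1 := by linarith
  have h1 : deriv (Real.log ∘ Real.Gamma) (x + 1 + 1) =
      1 / (x + 1) + deriv (Real.log ∘ Real.Gamma) (x + 1) := by
    have h2 := (differentiableAt_log_Gamma (by linarith : 0 < x + 1 + 1)).hasDerivAt.comp_add_const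
      (x + 1) 1
    have h3 := (Real.hasDerivAt_log hx1.ne').add (differentiableAt_log_Gamma hx1).hasDerivAt
    rw [one_div]
    refine h2.unique (h3.congr_of_eventuallyEq ?_)
    filter_upwards [lt_mem_nhds hx1] with y hy
    exact log_Gamma_add_one hy
  rw [digammaGap, digammaGap, h1, Real.log_div hx1.ne' hx.ne']
  ring

theorem integrableOn_binetDensity_mul_exp {x : ℝ} (hx : 0 < x) :
    IntegrableOn (fun t => binetDensity t * Real.exp (-x * t)) (Ioi 0) := by
  refine (exp_neg_integrableOn_Ioi 0 hx).mono'
    (measurable_binetDensity.mul (by fun_prop)).aestronglyMeasurable ?_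
  filter_upwards [ae_restrict_mem measurableSet_Ioi] with t ht
  have ht : 0 < t := ht
  rw [norm_mul, Real.norm_of_nonneg (binetDensity_nonneg ht), Real.norm_of_nonneg (by positivity)]
  exact mul_le_of_le_one_left (by positivity) (binetDensity_le_one ht)

/-- The Laplace transform of `1 / t - 1 / (e ^ t - 1)`. -/
noncomputable def binetLaplace (x : ℝ) : ℝ :=
  ∫ t in Ioi 0, binetDensity t * Real.exp (-x * t)

theorem binetLaplace_nonneg (x : ℝ) : 0 ≤ binetLaplace x :=
  setIntegral_nonneg measurableSet_Ioi fun _ ht =>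
    mul_nonneg (binetDensity_nonneg ht) (Real.exp_pos _).le

theorem binetLaplace_le_inv {x : ℝ} (hx : 0 < x) : binetLaplace x ≤ 1 / x := by
  have h := setIntegral_mono_on (integrableOn_binetDensity_mul_exp hx)
    (exp_neg_integrableOn_Ioi 0 hx) measurableSet_Ioi fun t ht =>
    mul_le_of_le_one_left (Real.exp_pos (-x * t)).le (binetDensity_le_one ht)
  refine h.trans (le_of_eq ?_)
  rw [integral_exp_mul_Ioi (by linarith)]
  simp

theorem binetLaplace_add_one {x : ℝ} (hx : 0 < x) :
    binetLaplace x - binetLaplace (x + 1) = Real.log ((x + 1) / x) - 1 / (x + 1) := by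
  have hx1 : 0 < x + 1 := by linarith
  have hd := (integrableOn_binetDensity_mul_exp hx).sub (integrableOn_binetDensity_mul_exp hx1)
  have he := exp_neg_integrableOn_Ioi 0 hx1
  -- The `1/(e^t - 1)` part of the difference collapses to `-e^{-(x+1)t}`; adding this exponential
  -- back leaves a Frullani integrand.
  have heq : ∀ t ∈ Ioi (0 : ℝ), binetDensity t * Real.exp (-x * t) -
      binetDensity t * Real.exp (-(x + 1) * t) + Real.exp (-(x + 1) * t) =
      t⁻¹ • (Real.exp (-(x * t)) - Real.exp (-((x + 1) * t))) := by
    intro t ht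
    have ht : 0 < t := ht
    have h1 := exp_sub_one_pos ht
    have h2 : Real.exp (-x * t) = Real.exp t * Real.exp (-(x + 1) * t) := by
      rw [← Real.exp_add]; ring_nf
    rw [← neg_mul, ← neg_mul, h2, binetDensity, smul_eq_mul]
    field_simp
    ring
  have hF := Frullani.integral_Ioi_eq (f := fun t => Real.exp (-t)) (a := x) (b := x + 1)
    (L := 1) (R := 0)
    ((by fun_prop : Continuous fun t : ℝ => Real.exp (-t)).locallyIntegrable.locallyIntegrableOn _)
    hx hx1
    (by
      have : Tendsto (fun t : ℝ => Real.exp (-t)) (𝓝 0) (𝓝 (Real.exp (-0))) :=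
        (by fun_prop : Continuous fun t : ℝ => Real.exp (-t)).tendsto 0
      rw [neg_zero, Real.exp_zero] at this
      exact this.mono_left nhdsWithin_le_nhds)
    (Real.tendsto_exp_neg_atTop_nhds_zero)
    (IntegrableOn.congr_fun (hd.add he) (fun t ht => heq t ht) measurableSet_Ioi)
  rw [← setIntegral_congr_fun measurableSet_Ioi heq] at hF
  have h1 := integral_add hd he
  have h2 := integral_sub (integrableOn_binetDensity_mul_exp hx)
    (integrableOn_binetDensity_mul_exp hx1)
  simp only [Pi.sub_apply] at h1
  rw [h1, h2, integral_exp_mul_Ioi (by linarith)] at hF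
  have h3 : -Real.exp (-(x + 1) * 0) / -(x + 1) = 1 / (x + 1) := by
    rw [mul_zero, Real.exp_zero, neg_div_neg_eq]
  rw [h3, sub_zero, smul_eq_mul, mul_one] at hF
  rw [binetLaplace, binetLaplace]
  linarith

/-- **Binet's formula** `ψ (x + 1) - log x = ∫ (1 / t - 1 / (e ^ t - 1)) e ^ (-x t) dt`. -/
theorem digammaGap_eq_binetLaplace {x : ℝ} (hx : 0 < x) : digammaGap x = binetLaplace x := by
  -- Both sides satisfy the same difference equation, so their difference is unchanged under `x ↦ x
  -- + 1`. Both lie in `[0, 1/x]`, so it is zero.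
  have hper : ∀ n : ℕ, digammaGap x - binetLaplace x =
      digammaGap (x + n) - binetLaplace (x + n) := by
    intro n
    induction n with
    | zero => simp
    | succ n ih =>
      have hxn : 0 < x + n := by positivity
      have h1 := digammaGap_add_one hxn
      have h2 := binetLaplace_add_one hxn
      rw [ih]
      push_cast
      rw [← add_assoc]
      linarith
  have hlim : Tendsto (fun n : ℕ => 1 / (x + n)) atTop (𝓝 0) := by
    simp_rw [one_div]
    exact tendsto_inv_atTop_zero.comp
      (tendsto_atTop_add_const_left _ _ tendsto_natCast_atTop_atTop)
  have hle : ∀ n : ℕ, |digammaGap x - binetLaplace x| ≤ 1 / (x + n) := by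
    intro n
    have hxn : 0 < x + n := by positivity
    rw [hper n, abs_le]
    constructor <;> linarith [digammaGap_nonneg hxn, digammaGap_le_inv hxn,
      binetLaplace_nonneg (x + n), binetLaplace_le_inv hxn]
  exact sub_eq_zero.1 (abs_eq_zero.1 (le_antisymm (ge_of_tendsto' hlim hle) (abs_nonneg _)))

/-! ### Mellin transform of `ψ(x + 1) - log x` -/

/-- Tonelli: integrating the norm in `x` gives `Γ(re s) t^{-re s}` times the density, whose integral
is the absolutely convergent Mellin integral at `1 - s`. -/
theorem integrable_cpow_mul_binetDensity_mul_exp {s : ℂ} (hs : 0 < s.re) (hs1 : s.re < 1) :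
    Integrable (fun z : ℝ × ℝ => (z.1 : ℂ) ^ (s - 1) *
      ((binetDensity z.2 : ℂ) * Complex.exp (-(z.2 * z.1))))
      ((volume.restrict (Ioi 0)).prod (volume.restrict (Ioi 0))) := by
  have hmeas : AEStronglyMeasurable (fun z : ℝ × ℝ => (z.1 : ℂ) ^ (s - 1) *
      ((binetDensity z.2 : ℂ) * Complex.exp (-(z.2 * z.1))))
      ((volume.restrict (Ioi 0)).prod (volume.restrict (Ioi 0))) := by
    have := measurable_binetDensity
    exact Measurable.aestronglyMeasurable (by fun_prop)
  have hnorm : ∀ t ∈ Ioi (0 : ℝ), ∀ x ∈ Ioi (0 : ℝ), ‖(x : ℂ) ^ (s - 1) *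
      ((binetDensity t : ℂ) * Complex.exp (-(t * x)))‖ =
      binetDensity t * (x ^ (s.re - 1) * Real.exp (-(t * x))) := by
    intro t ht x hx
    rw [norm_mul, norm_mul, Complex.norm_cpow_eq_rpow_re_of_pos hx, Complex.norm_real,
      Real.norm_of_nonneg (binetDensity_nonneg ht), Complex.norm_exp]
    simp
    ring
  rw [integrable_prod_iff' hmeas]
  constructor
  · filter_upwards [ae_restrict_mem measurableSet_Ioi] with t ht
    have h0 : 0 < t := ht
    have h1 : IntegrableOn (fun x : ℝ => x ^ (s.re - 1) * Real.exp (-(t * x))) (Ioi 0) := by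
      refine Integrable.of_integral_ne_zero ?_
      rw [Real.integral_rpow_mul_exp_neg_mul_Ioi hs h0]
      have := Real.Gamma_pos_of_pos hs
      positivity
    have hm : Measurable fun x : ℝ => (x : ℂ) ^ (s - 1) *
        ((binetDensity t : ℂ) * Complex.exp (-(t * x))) := by fun_prop
    refine (h1.const_mul (binetDensity t)).mono' hm.aestronglyMeasurable ?_
    filter_upwards [ae_restrict_mem measurableSet_Ioi] with x hx
    exact (hnorm t ht x hx).le
  · have h2 := (hasMellin_binetDensity (s := 1 - s) (by simp; linarith) (by simp; linarith)).1.norm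
    refine (Integrable.const_mul h2 (Real.Gamma s.re)).congr ?_
    filter_upwards [ae_restrict_mem measurableSet_Ioi] with t ht
    rw [setIntegral_congr_fun measurableSet_Ioi (hnorm t ht), integral_const_mul,
      Real.integral_rpow_mul_exp_neg_mul_Ioi hs ht, norm_smul,
      Complex.norm_cpow_eq_rpow_re_of_pos ht, Complex.norm_real,
      Real.norm_of_nonneg (binetDensity_nonneg ht), one_div, Real.inv_rpow (le_of_lt ht),
      ← Real.rpow_neg (le_of_lt ht)]
    simp
    ring

/-- The Mellin transform of `ψ (x + 1) - log x` on the strip `0 < re s < 1`. -/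
theorem hasMellin_digammaGap {s : ℂ} (hs : 0 < s.re) (hs1 : s.re < 1) :
    HasMellin (fun x => (digammaGap x : ℂ)) s
      (-(Real.pi / Complex.sin (Real.pi * s)) * riemannZeta (1 - s)) := by
  have hint := integrable_cpow_mul_binetDensity_mul_exp hs hs1
  have hfun : ∀ x ∈ Ioi (0 : ℝ), (x : ℂ) ^ (s - 1) • (digammaGap x : ℂ) =
      ∫ t in Ioi (0 : ℝ), (x : ℂ) ^ (s - 1) *
      ((binetDensity t : ℂ) * Complex.exp (-(t * x))) := by
    intro x hx
    rw [integral_const_mul, digammaGap_eq_binetLaplace hx, binetLaplace, ← integral_complex_ofReal,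
      smul_eq_mul]
    congr 2
    ext t
    push_cast
    ring_nf
  have hfun2 : ∀ t ∈ Ioi (0 : ℝ), ∫ x in Ioi (0 : ℝ), (x : ℂ) ^ (s - 1) *
      ((binetDensity t : ℂ) * Complex.exp (-(t * x))) =
      Complex.Gamma s * ((t : ℂ) ^ ((1 - s) - 1) • (binetDensity t : ℂ)) := by
    intro t ht
    have h1 := Complex.integral_cpow_mul_exp_neg_mul_Ioi (a := s) (r := t) hs (by simpa using ht)
    have h2 : ∀ x : ℝ, (x : ℂ) ^ (s - 1) * ((binetDensity t : ℂ) * Complex.exp (-(t * x))) =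
      (binetDensity t : ℂ) * ((x : ℂ) ^ (s - 1) * Complex.exp (-(t * x))) := fun x => by ring
    simp_rw [h2]
    rw [integral_const_mul, h1, one_div, Complex.inv_cpow _ _ (by
      rw [Complex.arg_ofReal_of_nonneg (le_of_lt ht)]; exact Real.pi_pos.ne), ← Complex.cpow_neg,
      smul_eq_mul]
    ring_nf
  constructor
  · exact hint.integral_prod_left.congr (by
      filter_upwards [ae_restrict_mem measurableSet_Ioi] with x hx
      exact (hfun x hx).symm)
  · have hM := (hasMellin_binetDensity (s := 1 - s) (by simp; linarith) (by simp; linarith)).2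
    rw [mellin] at hM
    rw [mellin, setIntegral_congr_fun measurableSet_Ioi hfun, integral_integral_swap hint,
      setIntegral_congr_fun measurableSet_Ioi hfun2, integral_const_mul, hM,
      ← Complex.Gamma_mul_Gamma_one_sub]
    ring

/-! ### The convolution kernel and its Fourier transform -/

/-- The convolution kernel `e ^ (σ u) (ψ (e ^ u + 1) - u)`. -/
noncomputable def convKernel (σ u : ℝ) : ℂ := Real.exp (σ * u) * digammaGap (Real.exp u)

theorem exp_mul_digammaKernel (σ x y : ℝ) :
    (Real.exp (σ * x) : ℂ) * digammaKernel σ x y = convKernel σ (x - y) := by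
  rw [digammaKernel, convKernel, ← digamma_sub_log (Real.exp_pos _), Real.log_exp, ← mul_assoc,
    ← Complex.ofReal_mul, ← Real.exp_add]
  push_cast
  ring_nf

theorem measurable_digammaGap : Measurable digammaGap :=
  ((measurable_deriv _).comp (measurable_id.add_const 1)).sub Real.measurable_log

theorem measurable_convKernel (σ : ℝ) : Measurable (convKernel σ) := by
  have := measurable_digammaGap
  unfold convKernel
  fun_prop

theorem norm_convKernel (σ u : ℝ) :
    ‖convKernel σ u‖ = Real.exp (σ * u) * digammaGap (Real.exp u) := by
  rw [convKernel, norm_mul, Complex.norm_real, Complex.norm_real,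
    Real.norm_of_nonneg (Real.exp_pos _).le,
    Real.norm_of_nonneg (digammaGap_nonneg (Real.exp_pos _))]

theorem norm_convKernel_le {σ : ℝ} (h0 : 0 < σ) (h1 : σ < 1) (u : ℝ) :
    ‖convKernel σ u‖ ≤ 1 / σ := by
  rw [norm_convKernel]
  have hσ : 1 ≤ 1 / σ := by rw [le_div_iff₀ h0]; linarith
  rcases le_total 0 u with hu | hu
  · have h2 := digammaGap_le_inv (Real.exp_pos u)
    calc Real.exp (σ * u) * digammaGap (Real.exp u) ≤ Real.exp (σ * u) * (1 / Real.exp u) := by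
          gcongr
      _ = Real.exp ((σ - 1) * u) := by
          rw [one_div, ← Real.exp_neg, ← Real.exp_add]; ring_nf
      _ ≤ 1 := Real.exp_le_one_iff.2 (mul_nonpos_of_nonpos_of_nonneg (by linarith) hu)
      _ ≤ _ := hσ
  · have h2 := digammaGap_le (Real.exp_pos u)
    have h3 : Real.log (Real.exp u + 1) ≤ 1 := by
      refine (Real.log_le_sub_one_of_pos (by positivity)).trans ?_
      linarith [Real.exp_le_one_iff.2 hu]
    rw [Real.log_exp] at h2
    -- From `1 + v ≤ e^v` at `v = -σu`, divided by `σ`, together with `1 ≤ 1/σ`.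
    have h4 : 1 - u ≤ 1 / σ * Real.exp (-(σ * u)) := by
      rw [one_div, ← div_eq_inv_mul, le_div_iff₀ h0]
      nlinarith [Real.add_one_le_exp (-(σ * u))]
    calc Real.exp (σ * u) * digammaGap (Real.exp u)
        ≤ Real.exp (σ * u) * (1 / σ * Real.exp (-(σ * u))) := by gcongr; linarith
      _ = 1 / σ * (Real.exp (σ * u) * Real.exp (-(σ * u))) := by ring
      _ = 1 / σ := by rw [← Real.exp_add, add_neg_cancel, Real.exp_zero, mul_one]

theorem integrable_convKernel {σ : ℝ} (h0 : 0 < σ) (h1 : σ < 1) : Integrable (convKernel σ) := by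
  have h := (hasMellin_digammaGap (s := σ) (by simpa) (by simpa)).1
  have himg : Real.exp '' univ = Ioi 0 := by rw [image_univ, Real.range_exp]
  rw [MellinConvergent, ← himg, integrableOn_image_iff_integrableOn_abs_deriv_smul
    MeasurableSet.univ (fun x _ => (Real.hasDerivAt_exp x).hasDerivWithinAt)
    Real.exp_injective.injOn, integrableOn_univ] at h
  refine h.congr (Eventually.of_forall fun u => ?_)
  have hu : (Real.exp u : ℂ) ≠ 0 := by exact_mod_cast (Real.exp_pos u).ne'
  have h2 : (Real.exp u : ℂ) ^ (σ : ℂ) = Real.exp (σ * u) := by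
    rw [← Complex.ofReal_cpow (Real.exp_pos u).le, ← Real.exp_mul, mul_comm]
  simp only [abs_of_pos (Real.exp_pos u), Complex.real_smul, smul_eq_mul]
  rw [Complex.cpow_sub _ _ hu, Complex.cpow_one, h2, convKernel]
  field_simp

theorem memLp_two_convKernel {σ : ℝ} (h0 : 0 < σ) (h1 : σ < 1) :
    MemLp (convKernel σ) 2 volume := by
  rw [memLp_two_iff_integrable_sq_norm (measurable_convKernel σ).aestronglyMeasurable]
  refine ((integrable_convKernel h0 h1).norm.const_mul (1 / σ)).mono'
    ((measurable_convKernel σ).norm.pow_const 2).aestronglyMeasurable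
    (Eventually.of_forall fun u => ?_)
  rw [norm_pow, norm_norm, sq]
  exact mul_le_mul_of_nonneg_right (norm_convKernel_le h0 h1 u) (norm_nonneg _)

/-- The Fourier transform of the kernel is a quotient of the zeta function by a sine. -/
theorem fourierInv_convKernel {σ : ℝ} (h0 : 0 < σ) (h1 : σ < 1) (t : ℝ) :
    𝓕⁻ (convKernel σ) (t / (2 * Real.pi)) =
      -(Real.pi / Complex.sin (Real.pi * (σ + Complex.I * t))) *
        riemannZeta (1 - σ - Complex.I * t) := by
  have h2 := mellin_eq_fourier (fun x => (digammaGap x : ℂ)) (s := σ + Complex.I * t)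
  rw [(hasMellin_digammaGap (by simpa) (by simpa)).2] at h2
  have h3 : (fun u : ℝ => Real.exp (-(σ + Complex.I * t : ℂ).re * u) •
      (digammaGap (Real.exp (-u)) : ℂ)) = fun u => convKernel σ (-u) := by
    ext u
    simp [convKernel]
  rw [h3] at h2
  rw [Real.fourierInv_eq_fourier_comp_neg]
  simp at h2
  rw [← h2]
  ring_nf

/-! ### Fourier transform on `L¹ ∩ L²` -/

theorem integral_fourier_mul_eq {f g : ℝ → ℂ} (hf : Integrable f) (hg : Integrable g) :
    ∫ x, 𝓕 f x * g x = ∫ x, f x * 𝓕 g x := by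
  have := VectorFourier.integral_fourierIntegral_smul_eq_flip (L := innerₗ ℝ) (e := 𝐞)
    (μ := volume) (ν := volume) Real.continuous_fourierChar continuous_inner hf hg
  rw [flip_innerₗ] at this
  exact this

theorem integral_fourierInv_mul_eq {f g : ℝ → ℂ} (hf : Integrable f) (hg : Integrable g) :
    ∫ x, 𝓕⁻ f x * g x = ∫ x, f x * 𝓕⁻ g x := by
  have h := integral_fourier_mul_eq hf (hg.comp_neg)
  rw [← Real.fourierInv_eq_fourier_comp_neg] at h
  rw [← h, ← integral_neg_eq_self]
  simp only [Real.fourierInv_eq_fourier_neg, neg_neg]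

/-- The Plancherel transform of an integrable function is given by the Fourier integral. -/
theorem coeFn_fourier_toLp {f : ℝ → ℂ} (hf : Integrable f) (hf2 : MemLp f 2 volume) :
    (𝓕 (hf2.toLp f) : Lp ℂ 2 (volume : Measure ℝ)) =ᵐ[volume] 𝓕 f := by
  have hcont : Continuous (𝓕 f) := VectorFourier.fourierIntegral_continuous
    Real.continuous_fourierChar (L := innerₗ ℝ) continuous_inner hf
  refine ae_eq_of_integral_contDiff_smul_eq ((Lp.memLp _).locallyIntegrable (by norm_num))
    hcont.locallyIntegrable fun g hg hgs => ?_
  have hg2 : ContDiff ℝ ∞ fun x => (g x : ℂ) := Complex.ofRealCLM.contDiff.comp hg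
  have hgs2 : HasCompactSupport fun x => (g x : ℂ) := hgs.comp_left (g := fun x : ℝ => (x : ℂ)) rfl
  set G : 𝓢(ℝ, ℂ) := hgs2.toSchwartzMap hg2 with hG
  have hGx : ∀ x, G x = g x := fun x => rfl
  have h1 := congrArg (fun T => T G) (Lp.fourier_toTemperedDistribution_eq (hf2.toLp f))
  simp only [TemperedDistribution.fourier_apply, Lp.toTemperedDistribution_apply] at h1
  have h2 : ∫ x, (𝓕 G) x • (hf2.toLp f) x = ∫ x, f x * 𝓕 (G : ℝ → ℂ) x := by
    refine integral_congr_ae ?_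
    filter_upwards [hf2.coeFn_toLp] with x hx
    rw [hx, smul_eq_mul, mul_comm, SchwartzMap.fourier_coe]
  rw [h2, ← integral_fourier_mul_eq hf G.integrable] at h1
  simp only [smul_eq_mul, hGx] at h1
  simp only [Complex.real_smul]
  rw [← h1]
  exact integral_congr_ae (Eventually.of_forall fun x => mul_comm _ _)

theorem coeFn_fourierInv_toLp {f : ℝ → ℂ} (hf : Integrable f) (hf2 : MemLp f 2 volume) :
    (𝓕⁻ (hf2.toLp f) : Lp ℂ 2 (volume : Measure ℝ)) =ᵐ[volume] 𝓕⁻ f := by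
  have hcont : Continuous (𝓕⁻ f) := by
    rw [Real.fourierInv_eq_fourier_comp_neg]
    exact VectorFourier.fourierIntegral_continuous
      Real.continuous_fourierChar (L := innerₗ ℝ) continuous_inner hf.comp_neg
  refine ae_eq_of_integral_contDiff_smul_eq ((Lp.memLp _).locallyIntegrable (by norm_num))
    hcont.locallyIntegrable fun g hg hgs => ?_
  have hg2 : ContDiff ℝ ∞ fun x => (g x : ℂ) := Complex.ofRealCLM.contDiff.comp hg
  have hgs2 : HasCompactSupport fun x => (g x : ℂ) := hgs.comp_left (g := fun x : ℝ => (x : ℂ)) rfl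
  set G : 𝓢(ℝ, ℂ) := hgs2.toSchwartzMap hg2 with hG
  have hGx : ∀ x, G x = g x := fun x => rfl
  have h1 := congrArg (fun T => T G) (Lp.fourierInv_toTemperedDistribution_eq (hf2.toLp f))
  simp only [TemperedDistribution.fourierInv_apply, Lp.toTemperedDistribution_apply] at h1
  have h2 : ∫ x, (𝓕⁻ G) x • (hf2.toLp f) x = ∫ x, f x * 𝓕⁻ (G : ℝ → ℂ) x := by
    refine integral_congr_ae ?_
    filter_upwards [hf2.coeFn_toLp] with x hx
    rw [hx, smul_eq_mul, mul_comm, SchwartzMap.fourierInv_coe]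
  rw [h2, ← integral_fourierInv_mul_eq hf G.integrable] at h1
  simp only [smul_eq_mul, hGx] at h1
  simp only [Complex.real_smul]
  rw [← h1]
  exact integral_congr_ae (Eventually.of_forall fun x => mul_comm _ _)

open ComplexConjugate in
/-- The multiplication formula `∫ f (𝓕 q) = ∫ (𝓕 f) q` for `f` in `L¹ ∩ L²` and `q` in `L²`. -/
theorem integral_mul_fourier_Lp {f : ℝ → ℂ} (hf : Integrable f) (hf2 : MemLp f 2 volume)
    (q : Lp ℂ 2 (volume : Measure ℝ)) :
    ∫ x, f x * (𝓕 q : Lp ℂ 2 (volume : Measure ℝ)) x = ∫ x, 𝓕 f x * q x := by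
  have hc : Integrable fun x => conj (f x) := by
    exact Complex.conjCLE.toContinuousLinearMap.integrable_comp hf
  have hc2 : MemLp (fun x => conj (f x)) 2 volume := hf2.star
  -- Parseval is sesquilinear and the formula bilinear; conjugating `f` exchanges `𝓕` and `𝓕⁻`.
  have hF : ∀ x, 𝓕⁻ (fun x => conj (f x)) x = conj (𝓕 f x) := by
    intro x
    rw [Real.fourierInv_eq', Real.fourier_eq', ← integral_conj]
    congr 1
    ext v
    simp only [smul_eq_mul, map_mul, ← Complex.exp_conj, Complex.conj_I, Complex.conj_ofReal]
    congr 2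
    push_cast
    ring
  have h1 := Lp.inner_fourier_eq (𝓕⁻ (hc2.toLp _)) q
  rw [FourierTransform.fourier_fourierInv_eq, L2.inner_def, L2.inner_def] at h1
  have h2 : ∫ x, f x * (𝓕 q : Lp ℂ 2 (volume : Measure ℝ)) x =
      ∫ x, inner ℂ ((hc2.toLp _) x) ((𝓕 q : Lp ℂ 2 (volume : Measure ℝ)) x) := by
    refine integral_congr_ae ?_
    filter_upwards [hc2.coeFn_toLp] with x hx
    rw [hx, RCLike.inner_apply]
    simp [mul_comm]
  rw [h2, h1]
  refine integral_congr_ae ?_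
  filter_upwards [coeFn_fourierInv_toLp hc hc2] with x hx
  rw [hx, hF, RCLike.inner_apply]
  simp [mul_comm]

/-! ### Dilations, and zeta on vertical lines -/

theorem quasiMeasurePreserving_div {c : ℝ} (hc : c ≠ 0) :
    Measure.QuasiMeasurePreserving (fun x : ℝ => x / c) volume volume := by
  refine ⟨by fun_prop, ?_⟩
  simp_rw [div_eq_mul_inv]
  rw [Real.map_volume_mul_right (inv_ne_zero hc)]
  exact Measure.smul_absolutelyContinuous

theorem MeasureTheory.MemLp.comp_div_real {f : ℝ → ℂ} {p : ENNReal} (hf : MemLp f p volume)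
    {c : ℝ} (hc : c ≠ 0) : MemLp (fun x => f (x / c)) p volume := by
  have hmap : Measure.map (fun x : ℝ => x / c) volume = ENNReal.ofReal |c⁻¹⁻¹| • volume := by
    simp_rw [div_eq_mul_inv]
    exact Real.map_volume_mul_right (inv_ne_zero hc)
  have h1 : MemLp f p (Measure.map (fun x : ℝ => x / c) volume) := by
    rw [hmap]
    exact hf.smul_measure ENNReal.ofReal_ne_top
  exact (memLp_map_measure_iff h1.1 (by fun_prop)).1 h1

theorem sin_pi_mul_ne_zero_of_re_mem {s : ℂ} (h0 : 0 < s.re) (h1 : s.re < 1) :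
    Complex.sin (Real.pi * s) ≠ 0 := by
  rw [Ne, Complex.sin_eq_zero_iff]
  rintro ⟨k, hk⟩
  have hs : s = k := by
    have : (Real.pi : ℂ) ≠ 0 := by exact_mod_cast Real.pi_pos.ne'
    rw [mul_comm] at hk
    exact mul_right_cancel₀ this hk
  rw [hs] at h0 h1
  simp only [Complex.intCast_re] at h0 h1
  have h2 : 0 < k := by exact_mod_cast h0
  have h3 : k < 1 := by exact_mod_cast h1
  omega

theorem countable_riemannZetaZeros : riemannZetaZeros.Countable := by
  have h : riemannZetaZeros = ⋃ n : ℕ, Metric.closedBall 0 n ∩ riemannZetaZeros := by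
    rw [← iUnion_inter, Metric.iUnion_closedBall_nat, univ_inter]
  rw [h]
  exact countable_iUnion fun n =>
    (IsCompact.inter_riemannZetaZeros_finite (isCompact_closedBall 0 _)).countable

theorem ae_riemannZeta_vertical_ne_zero (a : ℂ) :
    ∀ᵐ y : ℝ, riemannZeta (a - Complex.I * y) ≠ 0 := by
  have hinj : Function.Injective fun y : ℝ => a - Complex.I * y := by
    intro y z h
    simpa using h
  exact (countable_riemannZetaZeros.preimage_of_injOn hinj.injOn).ae_notMem volume

/-! ### Existence: the explicit solution -/

theorem isDigammaSolution_iff {σ : ℝ} {h φ : ℝ → ℂ} : IsDigammaSolution σ h φ ↔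
    IsSquareIntegrableAddBounded φ ∧ ∀ᵐ x : ℝ,
      Integrable (fun y => convKernel σ (x - y) * φ y) ∧
      h x = ∫ y, convKernel σ (x - y) * φ y := by
  refine and_congr_right fun _ => eventually_congr (Eventually.of_forall fun x => ?_)
  have h1 : (fun y => convKernel σ (x - y) * φ y) =
      fun y => (Real.exp (σ * x) : ℂ) * (digammaKernel σ x y * φ y) := by
    ext y
    rw [← exp_mul_digammaKernel, mul_assoc]
  have h2 : (Real.exp (σ * x) : ℂ) ≠ 0 := by exact_mod_cast (Real.exp_pos _).ne'
  rw [h1, integrable_const_mul_iff h2.isUnit, integral_const_mul]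

/-- The Fourier transform of a reflected, translated and dilated kernel. -/
theorem fourier_comp_sub_two_pi_mul (k : ℝ → ℂ) (x w : ℝ) :
    𝓕 (fun v => k (x - 2 * Real.pi * v)) w =
      1 / (2 * Real.pi) * (Complex.exp (-(Complex.I * x * w)) * 𝓕⁻ k (w / (2 * Real.pi))) := by
  have hpi : (Real.pi : ℂ) ≠ 0 := by exact_mod_cast Real.pi_pos.ne'
  set G : ℝ → ℂ := fun u => Complex.exp (-(Complex.I * (x - u) * w)) * k u with hG
  have h1 : 𝓕 (fun v => k (x - 2 * Real.pi * v)) w = ∫ v, G (x - 2 * Real.pi * v) := by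
    rw [Real.fourier_eq']
    congr 1
    ext v
    simp only [hG, smul_eq_mul]
    congr 2
    simp
    ring
  have h2 : 𝓕⁻ k (w / (2 * Real.pi)) = ∫ u, Complex.exp (Complex.I * x * w) * G u := by
    rw [Real.fourierInv_eq']
    congr 1
    ext u
    simp only [hG, smul_eq_mul, ← mul_assoc, ← Complex.exp_add]
    congr 2
    simp
    field_simp
    ring
  rw [h1, h2, integral_const_mul, ← mul_assoc (Complex.exp _), ← Complex.exp_add,
    Measure.integral_comp_mul_left (fun y => G (x - y)), integral_sub_left_eq_self G volume x,
    abs_of_pos (inv_pos.2 Real.two_pi_pos)]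
  simp

theorem memLp_explicitSolution {σ : ℝ} {h : ℝ → ℂ} (hh : MemLp h 2 volume)
    (hq : MemLp (zetaQuotient σ h hh) 2 volume) :
    MemLp (explicitSolution σ h hh hq) 2 volume :=
  ((Lp.memLp _).comp_div_real Real.two_pi_pos.ne').const_mul _

theorem MeasureTheory.MemLp.isSquareIntegrableAddBounded {φ : ℝ → ℂ} (hφ : MemLp φ 2 volume) :
    IsSquareIntegrableAddBounded φ :=
  ⟨φ, fun _ => 0, hφ, MemLp.zero', by simp⟩

theorem fourierInv_convKernel_mul_zetaQuotient {σ : ℝ} (h0 : 0 < σ) (h1 : σ < 1) {h : ℝ → ℂ}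
    (hh : MemLp h 2 volume) :
    ∀ᵐ w : ℝ, 𝓕⁻ (convKernel σ) (w / (2 * Real.pi)) * zetaQuotient σ h hh w =
      -Real.pi * plancherelPlus h hh w := by
  filter_upwards [ae_riemannZeta_vertical_ne_zero (1 - σ)] with w hw
  have hs := sin_pi_mul_ne_zero_of_re_mem (s := σ + Complex.I * w) (by simpa) (by simpa)
  rw [fourierInv_convKernel h0 h1, zetaQuotient]
  field_simp

theorem memLp_convKernel_sub {σ : ℝ} (h0 : 0 < σ) (h1 : σ < 1) (x : ℝ) :
    MemLp (fun y => convKernel σ (x - y)) 2 volume :=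
  (memLp_two_convKernel h0 h1).comp_measurePreserving (Measure.measurePreserving_sub_left volume x)

/-- A reflected, translated and dilated kernel is integrable. -/
theorem integrable_convKernel_dilate {σ : ℝ} (h0 : 0 < σ) (h1 : σ < 1) (x : ℝ) :
    Integrable (fun v => convKernel σ (x - 2 * Real.pi * v)) :=
  ((integrable_convKernel h0 h1).comp_sub_left x).comp_mul_left' Real.two_pi_pos.ne'

theorem memLp_convKernel_dilate {σ : ℝ} (h0 : 0 < σ) (h1 : σ < 1) (x : ℝ) :
    MemLp (fun v => convKernel σ (x - 2 * Real.pi * v)) 2 volume := by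
  have := (memLp_convKernel_sub h0 h1 x).comp_div_real (inv_ne_zero Real.two_pi_pos.ne')
  simpa [div_eq_mul_inv, mul_comm, mul_left_comm] using this

/-- Up to a constant, `H` is the product of the multiplier and `Q`, both in `L²`. Integrability lets
`h` be recovered from `H` by a genuine Fourier integral. -/
theorem integrable_plancherelPlus {σ : ℝ} (h0 : 0 < σ) (h1 : σ < 1) {h : ℝ → ℂ}
    (hh : MemLp h 2 volume) (hq : MemLp (zetaQuotient σ h hh) 2 volume) :
    Integrable (plancherelPlus h hh) := by
  have hm : MemLp (𝓕 (fun v => convKernel σ (0 - 2 * Real.pi * v))) 2 volume :=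
    (memLp_congr_ae (coeFn_fourier_toLp (integrable_convKernel_dilate h0 h1 0)
      (memLp_convKernel_dilate h0 h1 0))).1 (Lp.memLp _)
  have hi := hm.integrable_mul hq
  -- The product equals `(1/(2π)) (-π H) = -H/2`.
  refine (hi.const_mul (-2)).congr ?_
  filter_upwards [fourierInv_convKernel_mul_zetaQuotient h0 h1 hh] with w hw
  have hpi : (Real.pi : ℂ) ≠ 0 := by exact_mod_cast Real.pi_pos.ne'
  rw [Pi.mul_apply, fourier_comp_sub_two_pi_mul, mul_assoc, mul_assoc, hw]
  simp
  field_simp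

theorem integral_convKernel_mul_explicitSolution {σ : ℝ} (h0 : 0 < σ) (h1 : σ < 1) {h : ℝ → ℂ}
    (hh : MemLp h 2 volume) (hq : MemLp (zetaQuotient σ h hh) 2 volume) (x : ℝ) :
    ∫ y, convKernel σ (x - y) * explicitSolution σ h hh hq y =
      𝓕 ((𝓕⁻ (hh.toLp h) : Lp ℂ 2 (volume : Measure ℝ)) : ℝ → ℂ) x := by
  have hpi : (Real.pi : ℂ) ≠ 0 := by exact_mod_cast Real.pi_pos.ne'
  set F : Lp ℂ 2 (volume : Measure ℝ) := 𝓕 (hq.toLp _) with hF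
  set g : ℝ → ℂ := fun v => convKernel σ (x - 2 * Real.pi * v) * F v with hg
  have e1 : ∀ y, convKernel σ (x - y) * explicitSolution σ h hh hq y =
      -(1 / (2 * (Real.pi : ℂ) ^ 2)) * g (y / (2 * Real.pi)) := by
    intro y
    have : 2 * Real.pi * (y / (2 * Real.pi)) = y := by field_simp
    simp only [hg, this, explicitSolution, plancherelMinus]
    ring
  have e2 : ∫ v, g v = ∫ w : ℝ, -(1 / 2) * (Complex.exp (-(Complex.I * x * w)) *
      plancherelPlus h hh w) := by
    rw [hg, hF, integral_mul_fourier_Lp (integrable_convKernel_dilate h0 h1 x)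
      (memLp_convKernel_dilate h0 h1 x)]
    refine integral_congr_ae ?_
    filter_upwards [fourierInv_convKernel_mul_zetaQuotient h0 h1 hh, hq.coeFn_toLp] with w hw hw2
    rw [hw2, fourier_comp_sub_two_pi_mul, mul_assoc, mul_assoc, hw]
    field_simp
  have e3 : ∀ w : ℝ, Complex.exp (-(Complex.I * x * w)) * plancherelPlus h hh w =
      (fun v : ℝ => Complex.exp ((↑(-2 * Real.pi * inner ℝ v x) * Complex.I)) •
        (𝓕⁻ (hh.toLp h) : Lp ℂ 2 (volume : Measure ℝ)) v) (w / (2 * Real.pi)) := by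
    intro w
    simp only [plancherelPlus, smul_eq_mul]
    congr 2
    simp
    field_simp
  simp_rw [e1]
  rw [integral_const_mul, Measure.integral_comp_div g, e2, integral_const_mul]
  simp_rw [e3]
  rw [Measure.integral_comp_div (fun v : ℝ => Complex.exp
    ((↑(-2 * Real.pi * inner ℝ v x) * Complex.I)) •
        (𝓕⁻ (hh.toLp h) : Lp ℂ 2 (volume : Measure ℝ)) v), ← Real.fourier_eq',
    abs_of_pos Real.two_pi_pos]
  generalize 𝓕 ((𝓕⁻ (hh.toLp h) : Lp ℂ 2 (volume : Measure ℝ)) : ℝ → ℂ) x = J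
  simp only [Complex.real_smul]
  push_cast
  field_simp

theorem isDigammaSolution_explicitSolution {σ : ℝ} (h0 : 0 < σ) (h1 : σ < 1) {h : ℝ → ℂ}
    (hh : MemLp h 2 volume) (hq : MemLp (zetaQuotient σ h hh) 2 volume) :
    IsDigammaSolution σ h (explicitSolution σ h hh hq) := by
  rw [isDigammaSolution_iff]
  refine ⟨(memLp_explicitSolution hh hq).isSquareIntegrableAddBounded, ?_⟩
  have hi : Integrable ((𝓕⁻ (hh.toLp h) : Lp ℂ 2 (volume : Measure ℝ)) : ℝ → ℂ) :=
    (integrable_comp_div_iff _ Real.two_pi_pos.ne').1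
      (integrable_plancherelPlus h0 h1 hh hq)
  have hL := coeFn_fourier_toLp hi (Lp.memLp _)
  rw [Lp.toLp_coeFn, FourierTransform.fourier_fourierInv_eq] at hL
  filter_upwards [hL, hh.coeFn_toLp] with x hx hx2
  refine ⟨(memLp_convKernel_sub h0 h1 x).integrable_mul (memLp_explicitSolution hh hq), ?_⟩
  rw [integral_convKernel_mul_explicitSolution h0 h1, ← hx, hx2]

/-! ### Uniqueness in `L² + L^∞` -/

theorem IsSquareIntegrableAddBounded.aestronglyMeasurable {φ : ℝ → ℂ}
    (hφ : IsSquareIntegrableAddBounded φ) : AEStronglyMeasurable φ volume := by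
  obtain ⟨φ₁, φ₂, h1, h2, rfl⟩ := hφ
  exact h1.1.add h2.1

theorem IsSquareIntegrableAddBounded.sub {φ φ' : ℝ → ℂ} (hφ : IsSquareIntegrableAddBounded φ)
    (hφ' : IsSquareIntegrableAddBounded φ') :
    IsSquareIntegrableAddBounded (fun y => φ y - φ' y) := by
  obtain ⟨φ₁, φ₂, h1, h2, rfl⟩ := hφ
  obtain ⟨φ₁', φ₂', h1', h2', rfl⟩ := hφ'
  refine ⟨fun y => φ₁ y - φ₁' y, fun y => φ₂ y - φ₂' y, h1.sub h1', h2.sub h2', ?_⟩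
  ext y
  ring

/-- Convolution integrals of `L¹ ∩ L²` kernels against `L² + L^∞` functions are uniformly
bounded. -/
theorem IsSquareIntegrableAddBounded.exists_bound {φ : ℝ → ℂ}
    (hφ : IsSquareIntegrableAddBounded φ) {k : ℝ → ℂ} (hk : Integrable k)
    (hk2 : MemLp k 2 volume) :
    ∃ M : ℝ, ∀ x, Integrable (fun y => k (x - y) * φ y) ∧ ∫ y, ‖k (x - y) * φ y‖ ≤ M := by
  have hmeas := hφ.aestronglyMeasurable
  obtain ⟨φ₁, φ₂, h1, h2, rfl⟩ := hφ
  obtain ⟨C, hC⟩ : ∃ C : ℝ, ∀ᵐ y, ‖φ₂ y‖ ≤ C := by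
    refine ⟨(eLpNormEssSup φ₂ volume).toReal, ?_⟩
    filter_upwards [ae_le_eLpNormEssSup (f := φ₂)] with y hy
    have h3 : eLpNormEssSup φ₂ volume ≠ ⊤ := by
      rw [← eLpNorm_exponent_top]
      exact h2.2.ne
    simpa using ENNReal.toReal_mono h3 hy
  have hk2' := (memLp_two_iff_integrable_sq_norm hk2.1).1 hk2
  have h1' := (memLp_two_iff_integrable_sq_norm h1.1).1 h1
  -- The integral of this majorant does not depend on `x`, by translation invariance.
  have hdom : ∀ x, Integrable fun y => ‖k (x - y)‖ ^ 2 + ‖φ₁ y‖ ^ 2 + C * ‖k (x - y)‖ :=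
    fun x => ((hk2'.comp_sub_left x).add h1').add ((hk.norm.comp_sub_left x).const_mul C)
  have hle : ∀ x, ∀ᵐ y, ‖k (x - y) * (φ₁ y + φ₂ y)‖ ≤
      ‖k (x - y)‖ ^ 2 + ‖φ₁ y‖ ^ 2 + C * ‖k (x - y)‖ := by
    intro x
    filter_upwards [hC] with y hy
    rw [norm_mul]
    have h3 := mul_le_mul_of_nonneg_left (norm_add_le (φ₁ y) (φ₂ y)) (norm_nonneg (k (x - y)))
    have h4 := mul_le_mul_of_nonneg_left hy (norm_nonneg (k (x - y)))
    nlinarith [sq_nonneg (‖k (x - y)‖ - ‖φ₁ y‖), sq_nonneg ‖k (x - y)‖, sq_nonneg ‖φ₁ y‖]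
  have hint : ∀ x, Integrable fun y => k (x - y) * (φ₁ y + φ₂ y) := fun x =>
    (hdom x).mono' ((hk.comp_sub_left x).1.mul hmeas) (hle x)
  refine ⟨(∫ y, ‖k y‖ ^ 2) + (∫ y, ‖φ₁ y‖ ^ 2) + C * ∫ y, ‖k y‖, fun x => ⟨hint x, ?_⟩⟩
  refine (integral_mono_ae (hint x).norm (hdom x) (hle x)).trans (le_of_eq ?_)
  have e1 := integral_add ((hk2'.comp_sub_left x).add h1') ((hk.norm.comp_sub_left x).const_mul C)
  have e2 := integral_add (hk2'.comp_sub_left x) h1'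
  simp only [Pi.add_apply] at e1
  rw [e1, e2, integral_const_mul, integral_sub_left_eq_self (fun y => ‖k y‖ ^ 2) volume x,
    integral_sub_left_eq_self (fun y => ‖k y‖) volume x]

theorem integral_mul_convolution_swap {φ : ℝ → ℂ} (hφ : IsSquareIntegrableAddBounded φ)
    {k : ℝ → ℂ} (hkm : Measurable k) (hk : Integrable k) (hk2 : MemLp k 2 volume) {g : ℝ → ℂ}
    (hg : Integrable g) :
    ∫ x, g x * ∫ y, k (x - y) * φ y = ∫ y, φ y * ∫ x, k (x - y) * g x := by
  obtain ⟨M, hM⟩ := hφ.exists_bound hk hk2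
  have hmeas : AEStronglyMeasurable (fun z : ℝ × ℝ => g z.1 * (k (z.1 - z.2) * φ z.2))
      (volume.prod volume) :=
    hg.1.comp_fst.mul ((by fun_prop : Measurable fun z : ℝ × ℝ =>
      k (z.1 - z.2)).aestronglyMeasurable.mul hφ.aestronglyMeasurable.comp_snd)
  have hint : Integrable (fun z : ℝ × ℝ => g z.1 * (k (z.1 - z.2) * φ z.2))
      (volume.prod volume) := by
    rw [integrable_prod_iff hmeas]
    refine ⟨Eventually.of_forall fun x => (hM x).1.const_mul (g x), ?_⟩
    refine (hg.norm.mul_const M).mono' hmeas.norm.integral_prod_right'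
      (Eventually.of_forall fun x => ?_)
    rw [Real.norm_of_nonneg (integral_nonneg fun _ => norm_nonneg _)]
    simp_rw [norm_mul (g x)]
    rw [integral_const_mul]
    exact mul_le_mul_of_nonneg_left (hM x).2 (norm_nonneg _)
  simp_rw [← integral_const_mul]
  rw [integral_integral_swap hint]
  congr 1
  ext y
  congr 1
  ext x
  ring

theorem fourier_mul_exp (f : ℝ → ℂ) (y u : ℝ) :
    𝓕 (fun w : ℝ => Complex.exp (-(2 * Real.pi * w * y * Complex.I)) * f w) u = 𝓕 f (u + y) := by
  rw [Real.fourier_eq', Real.fourier_eq']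
  congr 1
  ext v
  rw [smul_eq_mul, smul_eq_mul, ← mul_assoc, ← Complex.exp_add]
  congr 2
  simp
  ring

theorem fourier_comp_sub (f : ℝ → ℂ) (a y : ℝ) :
    𝓕 (fun w => f (w - a)) y = Complex.exp (-(2 * Real.pi * a * y * Complex.I)) * 𝓕 f y := by
  rw [Real.fourier_eq', Real.fourier_eq', ← integral_add_right_eq_self _ a, ← integral_const_mul]
  congr 1
  ext v
  rw [smul_eq_mul, smul_eq_mul, ← mul_assoc, ← Complex.exp_add, add_sub_cancel_right]
  congr 2
  simp
  ring

theorem integral_comp_sub_mul_fourier {k γ : ℝ → ℂ} (hk : Integrable k) (hγ : Integrable γ)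
    (y : ℝ) : ∫ x, k (x - y) * 𝓕 γ x = 𝓕 (fun w => 𝓕 k w * γ w) y := by
  have hexp : Integrable fun w : ℝ => Complex.exp (-(2 * Real.pi * w * y * Complex.I)) * γ w := by
    refine hγ.bdd_mul (c := 1) (by fun_prop : Continuous _).aestronglyMeasurable
      (Eventually.of_forall fun w => ?_)
    rw [Complex.norm_exp]
    simp
  have h := integral_fourier_mul_eq hk hexp
  simp_rw [fourier_mul_exp] at h
  rw [← integral_add_right_eq_self _ y]
  simp_rw [add_sub_cancel_right]
  rw [← h, Real.fourier_eq']
  congr 1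
  ext w
  rw [smul_eq_mul, ← mul_assoc, mul_comm (𝓕 k w), mul_assoc]
  congr 2
  simp
  ring

/-- An integrable function with vanishing Fourier transform vanishes. -/
theorem ae_eq_zero_of_fourier_eq_zero {f : ℝ → ℂ} (hf : Integrable f) (h : ∀ a, 𝓕 f a = 0) :
    f =ᵐ[volume] 0 := by
  refine ae_eq_zero_of_integral_contDiff_smul_eq_zero hf.locallyIntegrable fun g hg hgs => ?_
  have hg2 : ContDiff ℝ ∞ fun x => (g x : ℂ) := Complex.ofRealCLM.contDiff.comp hg
  have hgs2 : HasCompactSupport fun x => (g x : ℂ) := hgs.comp_left (g := fun x : ℝ => (x : ℂ)) rfl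
  set G : 𝓢(ℝ, ℂ) := hgs2.toSchwartzMap hg2 with hG
  have h1 := integral_fourier_mul_eq (𝓕⁻ G).integrable hf
  rw [← SchwartzMap.fourier_coe, FourierTransform.fourier_fourierInv_eq] at h1
  simp only [h, mul_zero, integral_zero] at h1
  simp only [Complex.real_smul]
  exact h1

theorem fourier_comp_mul (f : ℝ → ℂ) {c : ℝ} (hc : 0 < c) (y : ℝ) :
    𝓕 (fun t => f (c * t)) y = (c : ℂ)⁻¹ * 𝓕 f (y / c) := by
  have h := Measure.integral_comp_mul_left
    (fun v : ℝ => Complex.exp ((↑(-2 * Real.pi * inner ℝ v (y / c)) * Complex.I)) • f v) c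
  rw [abs_of_pos (inv_pos.2 hc), Complex.real_smul, Complex.ofReal_inv] at h
  rw [Real.fourier_eq', Real.fourier_eq', ← h]
  congr 1
  ext v
  congr 4
  simp
  field_simp

/-- A function in `L² + L^∞` annihilating the Fourier transforms of all test functions is zero. -/
theorem IsSquareIntegrableAddBounded.ae_eq_zero {φ : ℝ → ℂ} (hφ : IsSquareIntegrableAddBounded φ)
    (h : ∀ η : ℝ → ℂ, ContDiff ℝ ∞ η → HasCompactSupport η → ∫ y, φ y * 𝓕 η y = 0) :
    φ =ᵐ[volume] 0 := by
  -- The Fourier transform of `φ · 𝓕 η` at `a` is the pairing of `φ` with the transform of a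
  -- translate of `η`, hence zero.
  have key : ∀ η : ℝ → ℂ, ContDiff ℝ ∞ η → HasCompactSupport η →
      ∀ᵐ y, φ y * 𝓕 η y = 0 := by
    intro η hη hηs
    set E : 𝓢(ℝ, ℂ) := hηs.toSchwartzMap hη with hE
    have hEη : ∀ y, (𝓕⁻ E) (0 - y) = 𝓕 η y := by
      intro y
      rw [zero_sub, SchwartzMap.fourierInv_coe, Real.fourierInv_eq_fourier_neg, neg_neg]
      rfl
    obtain ⟨M, hM⟩ := hφ.exists_bound (𝓕⁻ E).integrable ((𝓕⁻ E).memLp 2)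
    have hint : Integrable fun y => φ y * 𝓕 η y := by
      refine (hM 0).1.congr (Eventually.of_forall fun y => ?_)
      simp only [hEη, mul_comm]
    refine ae_eq_zero_of_fourier_eq_zero hint fun a => ?_
    have h1 := h (fun w => η (w - a)) (hη.comp (contDiff_id.sub contDiff_const))
      (hηs.comp_homeomorph (Homeomorph.subRight a))
    rw [← h1, Real.fourier_eq']
    congr 1
    ext y
    rw [fourier_comp_sub, smul_eq_mul, mul_left_comm]
    congr 3
    simp
    ring
  let χ : ContDiffBump (0 : ℝ) := ⟨1, 2, one_pos, one_lt_two⟩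
  set X : ℝ → ℂ := fun t => (χ t : ℂ) with hX
  have hXd : ContDiff ℝ ∞ X := Complex.ofRealCLM.contDiff.comp χ.contDiff
  have hXs : HasCompactSupport X := χ.hasCompactSupport.comp_left (g := fun x : ℝ => (x : ℂ)) rfl
  have hX0 : 𝓕 X 0 ≠ 0 := by
    have h1 : 𝓕 X 0 = ((∫ t, χ t : ℝ) : ℂ) := by
      rw [Real.fourier_eq', ← integral_complex_ofReal]
      simp [hX]
    rw [h1]
    exact_mod_cast χ.integral_pos.ne'
  have hXc : Continuous (𝓕 X) := VectorFourier.fourierIntegral_continuous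
    Real.continuous_fourierChar (L := innerₗ ℝ) continuous_inner
    (hXd.continuous.integrable_of_hasCompactSupport hXs)
  -- Dilating spreads the transform: at each `y` the values `𝓕 X (y/(n+1))` tend to `𝓕 X 0 ≠ 0`, so
  -- countably many test functions force `φ y = 0`.
  have hall : ∀ n : ℕ, ∀ᵐ y, φ y * 𝓕 (fun t => X (((n : ℝ) + 1) * t)) y = 0 := fun n =>
    key _ (hXd.comp (contDiff_const.mul contDiff_id))
      (hXs.comp_homeomorph (Homeomorph.mulLeft₀ ((n : ℝ) + 1) (by positivity)))
  filter_upwards [ae_all_iff.2 hall] with y hy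
  have hlim : Tendsto (fun n : ℕ => 𝓕 X (y / ((n : ℝ) + 1))) atTop (𝓝 (𝓕 X 0)) :=
    (hXc.tendsto 0).comp (tendsto_const_nhds.div_atTop
      (tendsto_atTop_add_const_right _ _ tendsto_natCast_atTop_atTop))
  obtain ⟨n, hn⟩ := (hlim.eventually_ne hX0).exists
  have h2 := hy n
  rw [fourier_comp_mul X (by positivity)] at h2
  have h3 : (((n : ℝ) + 1 : ℝ) : ℂ)⁻¹ ≠ 0 := inv_ne_zero (by
    exact_mod_cast (by positivity : (n : ℝ) + 1 ≠ 0))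
  exact (mul_eq_zero.1 h2).resolve_right (mul_ne_zero h3 hn)

/-- A Wiener type uniqueness theorem for convolution equations whose kernel has a smooth
nonvanishing Fourier transform. -/
theorem IsSquareIntegrableAddBounded.ae_eq_zero_of_convolution_eq_zero {φ : ℝ → ℂ}
    (hφ : IsSquareIntegrableAddBounded φ) {k : ℝ → ℂ} (hkm : Measurable k) (hk : Integrable k)
    (hk2 : MemLp k 2 volume) (hsmooth : ContDiff ℝ ∞ fun w => (𝓕 k w)⁻¹)
    (hne : ∀ w, 𝓕 k w ≠ 0) (h : ∀ᵐ x, ∫ y, k (x - y) * φ y = 0) : φ =ᵐ[volume] 0 := by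
  refine hφ.ae_eq_zero fun η hη hηs => ?_
  -- Testing the equation against `𝓕 γ` and moving `k` across by Fubini gives `𝓕 (𝓕 k · γ) = 𝓕 η`
  -- under the integral.
  set γ : ℝ → ℂ := fun w => (𝓕 k w)⁻¹ * η w with hγ
  have hγd : ContDiff ℝ ∞ γ := hsmooth.mul hη
  have hγs : HasCompactSupport γ := hηs.mul_left
  set Γ : 𝓢(ℝ, ℂ) := hγs.toSchwartzMap hγd with hΓ
  have hΓγ : ((𝓕 Γ : 𝓢(ℝ, ℂ)) : ℝ → ℂ) = 𝓕 γ := SchwartzMap.fourier_coe Γ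
  have hint := (𝓕 Γ).integrable (μ := volume)
  rw [hΓγ] at hint
  have hswap := integral_mul_convolution_swap hφ hkm hk hk2 hint
  have hγint : Integrable γ := Γ.integrable
  simp_rw [integral_comp_sub_mul_fourier hk hγint] at hswap
  have h1 : (fun w => 𝓕 k w * γ w) = η := by
    ext w
    exact mul_inv_cancel_left₀ (hne w) (η w)
  have h2 : ∫ x, 𝓕 γ x * ∫ y, k (x - y) * φ y = 0 := by
    refine integral_eq_zero_of_ae ?_
    filter_upwards [h] with x hx
    rw [hx, mul_zero, Pi.zero_apply]
  rw [h2] at hswap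
  rw [h1] at hswap
  exact hswap.symm

/-! ### Zeros of zeta and the Riemann hypothesis -/

theorem RiemannHypothesis.riemannZeta_ne_zero (hRH : RiemannHypothesis) {s : ℂ} (h0 : 0 < s.re)
    (h1 : s.re < 1 / 2) : riemannZeta s ≠ 0 := by
  intro hs
  refine h1.ne (hRH s hs ?_ ?_)
  · rintro ⟨n, rfl⟩
    simp at h0
    linarith [(Nat.cast_nonneg n : (0 : ℝ) ≤ n)]
  · rintro rfl
    norm_num at h1

/-- Zeros of the zeta function in the closed left half plane are trivial. -/
theorem exists_eq_of_riemannZeta_eq_zero_of_re_nonpos {s : ℂ} (hs : riemannZeta s = 0)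
    (hre : s.re ≤ 0) : ∃ n : ℕ, s = -2 * (n + 1) := by
  have hs0 : s ≠ 0 := by
    rintro rfl
    rw [riemannZeta_zero] at hs
    norm_num at hs
  have hre' : 1 ≤ (1 - s).re := by simpa using hre
  have hnat : ∀ n : ℕ, 1 - s ≠ -n := by
    intro n hn
    rw [hn] at hre'
    simp at hre'
    linarith [(Nat.cast_nonneg n : (0 : ℝ) ≤ n)]
  have hfe := riemannZeta_one_sub (s := 1 - s) hnat (by simpa using hs0)
  rw [sub_sub_cancel, hs] at hfe
  have hpi : (2 * Real.pi : ℂ) ≠ 0 := by exact_mod_cast Real.two_pi_pos.ne'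
  -- In the functional equation the factors `Γ(1 - s)` and `ζ(1 - s)` do not vanish since `1 ≤ re (1
  -- - s)`, so the cosine must.
  have hcos : Complex.cos (Real.pi * (1 - s) / 2) = 0 := by
    have hΓ : Complex.Gamma (1 - s) ≠ 0 := Complex.Gamma_ne_zero hnat
    have hζ := riemannZeta_ne_zero_of_one_le_re hre'
    simpa [hΓ, hζ, Complex.cpow_eq_zero_iff, hpi] using hfe.symm
  obtain ⟨k, hk⟩ := Complex.cos_eq_zero_iff.1 hcos
  have hsk : s = -2 * k := by
    have hpi' : (Real.pi : ℂ) ≠ 0 := by exact_mod_cast Real.pi_pos.ne'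
    have h2 : (Real.pi : ℂ) * (1 - s) = Real.pi * (2 * k + 1) := by linear_combination 2 * hk
    linear_combination -(mul_left_cancel₀ hpi' h2)
  have hk0 : 0 < k := by
    have h3 : s.re = -2 * k := by rw [hsk]; simp
    have h4 : (0 : ℝ) ≤ k := by linarith
    have h5 : (0 : ℤ) ≤ k := by exact_mod_cast h4
    refine lt_of_le_of_ne h5 fun h => hs0 ?_
    rw [hsk, ← h]
    simp
  refine ⟨(k - 1).toNat, ?_⟩
  have h6 : (((k - 1).toNat : ℤ) : ℂ) = ((k - 1 : ℤ) : ℂ) := by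
    rw [Int.toNat_of_nonneg (by omega)]
  rw [hsk]
  push_cast at h6
  rw [h6]
  ring

/-- If the Riemann hypothesis fails, there is a zero in the open left half of the critical strip. -/
theorem exists_zero_of_not_riemannHypothesis (h : ¬ RiemannHypothesis) :
    ∃ s : ℂ, riemannZeta s = 0 ∧ 0 < s.re ∧ s.re < 1 / 2 := by
  unfold RiemannHypothesis at h
  push Not at h
  obtain ⟨s, hs, htriv, hs1, hre⟩ := h
  have h0 : 0 < s.re := by
    by_contra! hle
    obtain ⟨n, hn⟩ := exists_eq_of_riemannZeta_eq_zero_of_re_nonpos hs hle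
    exact htriv n hn
  have h1 : s.re < 1 := by
    by_contra! hle
    exact riemannZeta_ne_zero_of_one_le_re hle hs
  rcases lt_or_gt_of_ne hre with hlt | hgt
  · exact ⟨s, hs, h0, hlt⟩
  -- The functional equation reflects a zero from the right half into the left.
  · refine ⟨1 - s, ?_, by simpa using h1, by simp; linarith⟩
    rw [riemannZeta_one_sub (fun n hn => ?_) hs1, hs, mul_zero]
    rw [hn] at h0
    simp at h0
    linarith [(Nat.cast_nonneg n : (0 : ℝ) ≤ n)]

/-! ### Homogeneous solutions, uniqueness and conclusion -/

theorem isDigammaSolution_zero (σ : ℝ) :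
    IsDigammaSolution σ (fun _ => 0) (fun _ => 0) :=
  ⟨MemLp.zero'.isSquareIntegrableAddBounded, Eventually.of_forall fun x => by simp⟩

/-- A zero of the zeta function provides a bounded nonzero solution of the homogeneous equation. -/
theorem isDigammaSolution_exp {σ : ℝ} (h0 : 0 < σ) (h1 : σ < 1) {t : ℝ}
    (ht : riemannZeta (1 - σ - Complex.I * t) = 0) :
    IsDigammaSolution σ (fun _ => 0) (fun y => Complex.exp (-(Complex.I * t * y))) := by
  have hcont : Continuous fun y : ℝ => Complex.exp (-(Complex.I * t * y)) := by fun_prop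
  have hnorm : ∀ y : ℝ, ‖Complex.exp (-(Complex.I * t * y))‖ ≤ 1 := fun y => by
    rw [Complex.norm_exp]
    simp
  have hzero : 𝓕⁻ (convKernel σ) (t / (2 * Real.pi)) = 0 := by
    rw [fourierInv_convKernel h0 h1, ht, mul_zero]
  rw [isDigammaSolution_iff]
  refine ⟨⟨fun _ => 0, _, MemLp.zero', memLp_top_of_bound hcont.aestronglyMeasurable 1
    (Eventually.of_forall hnorm), by simp⟩, Eventually.of_forall fun x => ⟨?_, ?_⟩⟩
  · exact ((integrable_convKernel h0 h1).comp_sub_left x).mul_bdd (c := 1)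
      hcont.aestronglyMeasurable (Eventually.of_forall hnorm)
  -- Convolving `k` with a character multiplies it by the multiplier at `t`, here zero.
  · have h2 : ∀ y : ℝ, convKernel σ (x - y) * Complex.exp (-(Complex.I * t * y)) =
        (fun u : ℝ => convKernel σ u * Complex.exp (-(Complex.I * t * (x - u)))) (x - y) := by
      intro y
      simp
    simp_rw [h2]
    rw [integral_sub_left_eq_self (fun u : ℝ => convKernel σ u *
      Complex.exp (-(Complex.I * t * (x - u)))) volume x]
    have h3 : ∀ u : ℝ, convKernel σ u * Complex.exp (-(Complex.I * t * (x - u))) =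
        Complex.exp (-(Complex.I * t * x)) *
        (Complex.exp (((2 * Real.pi * inner ℝ u (t / (2 * Real.pi)) : ℝ) : ℂ) * Complex.I) •
          convKernel σ u) := by
      intro u
      rw [smul_eq_mul, ← mul_assoc, ← Complex.exp_add, mul_comm]
      congr 2
      have hpi : (Real.pi : ℂ) ≠ 0 := by exact_mod_cast Real.pi_pos.ne'
      simp
      field_simp
      ring
    simp_rw [h3]
    rw [integral_const_mul, ← Real.fourierInv_eq', hzero, mul_zero]

theorem fourier_convKernel {σ : ℝ} (h0 : 0 < σ) (h1 : σ < 1) (w : ℝ) :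
    𝓕 (convKernel σ) w =
      -(Real.pi / Complex.sin (Real.pi * (σ - 2 * Real.pi * w * Complex.I))) *
        riemannZeta (1 - σ + 2 * Real.pi * w * Complex.I) := by
  have hpi : Real.pi ≠ 0 := Real.pi_pos.ne'
  have h2 := fourierInv_convKernel h0 h1 (-(2 * Real.pi * w))
  have h3 : -(2 * Real.pi * w) / (2 * Real.pi) = -w := by field_simp
  rw [h3, Real.fourierInv_eq_fourier_neg, neg_neg] at h2
  rw [h2]
  push_cast
  congr 4 <;> ring

theorem contDiff_inv_fourier_convKernel {σ : ℝ} (h0 : 0 < σ) (h1 : σ < 1)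
    (hζ : ∀ s : ℂ, s.re = 1 - σ → riemannZeta s ≠ 0) :
    ContDiff ℝ ∞ fun w => (𝓕 (convKernel σ) w)⁻¹ := by
  have heq : (fun w => (𝓕 (convKernel σ) w)⁻¹) = fun w : ℝ =>
      -(Complex.sin (Real.pi * (σ - 2 * Real.pi * w * Complex.I)) / Real.pi) *
        (riemannZeta (1 - σ + 2 * Real.pi * w * Complex.I))⁻¹ := by
    ext w
    rw [fourier_convKernel h0 h1, mul_inv, inv_neg, inv_div]
  have hlin : ContDiff ℝ ∞ fun w : ℝ => (1 - σ + 2 * Real.pi * w * Complex.I : ℂ) := by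
    have := Complex.ofRealCLM.contDiff (n := ∞)
    exact contDiff_const.add ((contDiff_const.mul this).mul contDiff_const)
  have hlin2 : ContDiff ℝ ∞ fun w : ℝ =>
      (Real.pi * (σ - 2 * Real.pi * w * Complex.I) : ℂ) := by
    have := Complex.ofRealCLM.contDiff (n := ∞)
    exact contDiff_const.mul (contDiff_const.sub ((contDiff_const.mul this).mul contDiff_const))
  rw [heq]
  refine (((Complex.contDiff_sin.restrict_scalars ℝ).comp hlin2).div_const _).neg.mul ?_
  rw [contDiff_iff_contDiffAt]
  intro w
  have hre : (1 - σ + 2 * Real.pi * w * Complex.I : ℂ).re = 1 - σ := by simp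
  have hne1 : (1 - σ + 2 * Real.pi * w * Complex.I : ℂ) ≠ 1 := by
    intro h
    rw [h] at hre
    simp at hre
    linarith
  have hz : ContDiffAt ℝ ∞ riemannZeta (1 - σ + 2 * Real.pi * w * Complex.I : ℂ) :=
    (analyticOn_riemannZeta _ hne1).contDiffAt.restrict_scalars ℝ
  exact (hz.comp w hlin.contDiffAt).inv (hζ _ hre)

/-- Uniqueness of solutions when the zeta function has no zeros on the line `re s = 1 - σ`. -/
theorem IsDigammaSolution.ae_eq {σ : ℝ} (h0 : 0 < σ) (h1 : σ < 1)
    (hζ : ∀ s : ℂ, s.re = 1 - σ → riemannZeta s ≠ 0) {h φ φ' : ℝ → ℂ}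
    (hφ : IsDigammaSolution σ h φ) (hφ' : IsDigammaSolution σ h φ') : φ' =ᵐ[volume] φ := by
  rw [isDigammaSolution_iff] at hφ hφ'
  have hne : ∀ w, 𝓕 (convKernel σ) w ≠ 0 := by
    intro w
    have hs := sin_pi_mul_ne_zero_of_re_mem (s := σ - 2 * Real.pi * w * Complex.I)
      (by simpa) (by simpa)
    have hpi : (Real.pi : ℂ) ≠ 0 := by exact_mod_cast Real.pi_pos.ne'
    rw [fourier_convKernel h0 h1]
    exact mul_ne_zero (neg_ne_zero.2 (div_ne_zero hpi hs)) (hζ _ (by simp))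
  have hd := (hφ'.1.sub hφ.1).ae_eq_zero_of_convolution_eq_zero (measurable_convKernel σ)
    (integrable_convKernel h0 h1) (memLp_two_convKernel h0 h1)
    (contDiff_inv_fourier_convKernel h0 h1 hζ) hne (by
      filter_upwards [hφ.2, hφ'.2] with x hx hx'
      simp_rw [mul_sub]
      rw [integral_sub hx'.1 hx.1, ← hx.2, ← hx'.2, sub_self])
  filter_upwards [hd] with y hy
  exact sub_eq_zero.1 hy

/-- Uniqueness for the homogeneous equation on each line implies the Riemann hypothesis. -/
theorem riemannHypothesis_of_homogeneous_unique
    (H : ∀ σ : ℝ, 1 / 2 < σ → σ < 1 → ∀ φ : ℝ → ℂ, IsDigammaSolution σ (fun _ => 0) φ →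
      φ =ᵐ[volume] fun _ => 0) : RiemannHypothesis := by
  by_contra hRH
  obtain ⟨s, hs, hs0, hs1⟩ := exists_zero_of_not_riemannHypothesis hRH
  -- These values make `1 - σ - it = s`.
  have hsol := isDigammaSolution_exp (σ := 1 - s.re) (t := -s.im) (by linarith) (by linarith)
    (by
      rw [← hs]
      congr 1
      apply Complex.ext <;> simp)
  obtain ⟨y, hy⟩ := (H _ (by linarith) (by linarith) _ hsol).exists
  exact Complex.exp_ne_zero _ hy

theorem theorem1p3 :
    -- RH holds iff the equation is uniquely solvable for each admissible right-hand side
    (RiemannHypothesis ↔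
      ∀ σ : ℝ, 1 / 2 < σ → σ < 1 →
        ∀ (h : ℝ → ℂ) (hh : MemLp h 2 volume), MemLp (zetaQuotient σ h hh) 2 volume →
          ∃ φ : ℝ → ℂ, IsDigammaSolution σ h φ ∧
            ∀ φ' : ℝ → ℂ, IsDigammaSolution σ h φ' → φ' =ᵐ[volume] φ) ∧
    -- RH holds iff there is at most one solution for each square integrable right-hand side
    (RiemannHypothesis ↔
      ∀ σ : ℝ, 1 / 2 < σ → σ < 1 →
        ∀ h : ℝ → ℂ, MemLp h 2 volume →
          ∀ φ φ' : ℝ → ℂ, IsDigammaSolution σ h φ → IsDigammaSolution σ h φ' →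
            φ' =ᵐ[volume] φ) ∧
    -- the explicit solution
    (∀ σ : ℝ, 1 / 2 < σ → σ < 1 →
      ∀ (h : ℝ → ℂ) (hh : MemLp h 2 volume) (hq : MemLp (zetaQuotient σ h hh) 2 volume),
        MemLp (explicitSolution σ h hh hq) 2 volume ∧
        IsDigammaSolution σ h (explicitSolution σ h hh hq) ∧
        (RiemannHypothesis → ∀ φ : ℝ → ℂ, IsDigammaSolution σ h φ →
          φ =ᵐ[volume] explicitSolution σ h hh hq)) := by
  have hline : RiemannHypothesis → ∀ σ : ℝ, 1 / 2 < σ → σ < 1 →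
      ∀ s : ℂ, s.re = 1 - σ → riemannZeta s ≠ 0 := fun hRH σ h0 h1 s hs =>
    hRH.riemannZeta_ne_zero (by linarith) (by linarith)
  refine ⟨⟨fun hRH σ h0 h1 h hh hq => ?_, fun H => ?_⟩,
    ⟨fun hRH σ h0 h1 h hh φ φ' hφ hφ' => ?_, fun H => ?_⟩, fun σ h0 h1 h hh hq => ?_⟩
  · have hsol := isDigammaSolution_explicitSolution (by linarith) h1 hh hq
    exact ⟨_, hsol, fun φ' hφ' =>
      IsDigammaSolution.ae_eq (by linarith) h1 (hline hRH σ h0 h1) hsol hφ'⟩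
  · refine riemannHypothesis_of_homogeneous_unique fun σ h0 h1 φ hφ => ?_
    have hzero : MemLp (fun _ : ℝ => (0 : ℂ)) 2 volume := MemLp.zero'
    -- For `h = 0` the quotient vanishes almost everywhere, so the assumed uniqueness covers the
    -- homogeneous equation.
    have hq : MemLp (zetaQuotient σ (fun _ => 0) hzero) 2 volume := by
      have hL : (𝓕⁻ (hzero.toLp _) : Lp ℂ 2 (volume : Measure ℝ)) = 0 := by
        rw [show hzero.toLp _ = 0 from MemLp.toLp_zero _]
        exact map_zero (Lp.fourierTransformₗᵢ ℝ ℂ).symm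
      refine (memLp_congr_ae ?_).2 (MemLp.zero' (ε := ℂ))
      have h2 : ∀ᵐ v : ℝ, (𝓕⁻ (hzero.toLp _) : Lp ℂ 2 (volume : Measure ℝ)) v = 0 := by
        rw [hL]
        exact Lp.coeFn_zero _ _ _
      filter_upwards [(quasiMeasurePreserving_div Real.two_pi_pos.ne').ae h2] with y hy
      rw [zetaQuotient, plancherelPlus, hy, mul_zero, zero_div]
    obtain ⟨ψ, -, hψ⟩ := H σ h0 h1 _ hzero hq
    exact (hψ φ hφ).trans (hψ _ (isDigammaSolution_zero σ)).symm
  · exact IsDigammaSolution.ae_eq (by linarith) h1 (hline hRH σ h0 h1) hφ hφ'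
  · exact riemannHypothesis_of_homogeneous_unique fun σ h0 h1 φ hφ =>
      H σ h0 h1 _ MemLp.zero' _ _ (isDigammaSolution_zero σ) hφ
  · have hsol := isDigammaSolution_explicitSolution (by linarith) h1 hh hq
    exact ⟨memLp_explicitSolution hh hq, hsol, fun hRH φ hφ =>
      IsDigammaSolution.ae_eq (by linarith) h1 (hline hRH σ h0 h1) hsol hφ⟩
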